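/- Let $T$ be a finite dimensional real vector space (e.g. $T=\mathbb{R}^N$, $N\ge 0$) with a Haar (Lebesgue) measure, and let $n\in\mathbb{N}_0$. Let $\mathcal{D}$ be the space of real valued test functions on $T$, $\mathcal{D}_n$ that on $T^n$ with its usual test function topology, $\otimes^n\mathcal{D}\subset\mathcal{D}_n$ the linear span of the products $(f_1\otimes\dots\otimes f_n)(x_1,\dots,x_n)=f_1(x_1)\cdots f_n(x_n)$ with $f_1,\dots,f_n\in\mathcal{D}$, and $\mathcal{D}^{\vee}_n{}'$ the space of totally symmetric distributions on $T^n$. Let $\mathcal{E}^{\vee}_n$ be the space of totally symmetric smooth real functions on $T^n$ with the topology of locally uniform convergence of all derivatives. For $h\in\mathcal{D}$ let $C_h g=h\star g$, and let $\otimes^n C_h$ be convolution by $h\otimes\dots\otimes h$ on $\mathcal{E}^\vee_n$. Let $$W^{\vee}_n=\big\{\,w:\mathcal{D}\setminus\{0\}\to\mathcal{E}^{\vee}_n\ \big|\ w(f)=\otimes^n C_h\,w(g)\ \text{ for all } f,g\in\mathcal{D}\setminus\{0\},\ h\in\mathcal{D}\text{ with } f=C_h g\,\big\},$$ with the coarsest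 topology for which all maps $w\mapsto w(f)$ are continuous. Put $\Pi_f w=w(f)$ for $f\ne0$, $\Pi_0w=0$, $f^t(x)=f(-x)$, and $$\widetilde w(f_1,\dots,f_n)=\frac1{n!}\sum_{\epsilon\in\{0,1\}^n}(-1)^{n-(\epsilon_1+\dots+\epsilon_n)}\big(\Pi_{\epsilon_1f_1^t+\dots+\epsilon_nf_n^t}\,w\big)(0)\qquad(f_1,\dots,f_n\in\mathcal{D}).$$ Then for every $w\in W^\vee_n$ there is exactly one $k(w)\in\mathcal{D}^{\vee}_n{}'$ with $(k(w)\,|\,f_1\otimes\dots\otimes f_n)=\widetilde w(f_1,\dots,f_n)$ for all $f_1,\dots,f_n\in\mathcal{D}$. The map $k:W^{\vee}_n\to\mathcal{D}^{\vee}_n{}'$ is linear, and bijective if $n\ge1$. It is continuous when $\mathcal{D}^{\vee}_n{}'$ carries the weak topology against $\otimes^n\mathcal{D}$, and it is sequentially continuous when $\mathcal{D}^{\vee}_n{}'$ carries its strong dual topology (uniform convergence on bounded subsets of $\mathcal{D}_n$). -/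

import Mathlib

open MeasureTheory TopologicalSpace
open scoped Topology Convolution

noncomputable section

namespace Wilson

/-! ### Test functions -/

/-- The space `𝒟(X)` of real valued compactly supported smooth functions on `X`, with its canonical
locally convex inductive limit topology. -/
abbrev Test (X : Type*) [NormedAddCommGroup X] [NormedSpace ℝ X] : Type _ :=
  TestFunction (⊤ : Opens X) ℝ ⊤

section Test

variable {T : Type*} [NormedAddCommGroup T] [NormedSpace ℝ T]

/-- The reflected test function `fᵗ(x) = f(-x)`. -/
def reflect (f : Test T) : Test T where
  toFun x := f (-x)
  contDiff' := f.contDiff.comp contDiff_neg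
  hasCompactSupport' := f.hasCompactSupport.comp_homeomorph (Homeomorph.neg T)
  tsupport_subset' := fun _ _ => trivial

/-- The convolution `C_h g = h ⋆ g`, that is `x ↦ ∫ h(y) g(x - y) dμ(y)`. -/
def conv [FiniteDimensional ℝ T] [MeasurableSpace T] [BorelSpace T]
    (μ : Measure T) [μ.IsAddHaarMeasure] (h g : Test T) : Test T where
  toFun := h ⋆[ContinuousLinearMap.mul ℝ ℝ, μ] g
  contDiff' := g.hasCompactSupport.contDiff_convolution_right _
    (h.continuous.locallyIntegrable) g.contDiff
  hasCompactSupport' := h.hasCompactSupport.convolution _ g.hasCompactSupport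
  tsupport_subset' := fun _ _ => trivial

/-- The elementary tensor `(f₁ ⊗ ⋯ ⊗ fₙ)(x₁, …, xₙ) = f₁(x₁) ⋯ fₙ(xₙ)`, a test function of `n`
variables. -/
def tensor {n : ℕ} (f : Fin n → Test T) : Test (Fin n → T) where
  toFun x := ∏ i, f i (x i)
  contDiff' := contDiff_prod fun i _ => (f i).contDiff.comp (contDiff_apply ℝ T i)
  hasCompactSupport' := by
    refine HasCompactSupport.intro
      (isCompact_univ_pi fun i => (f i).hasCompactSupport.isCompact) fun x hx => ?_
    obtain ⟨i, hi⟩ : ∃ i, x i ∉ tsupport (f i) := by simpa [Set.mem_pi] using hx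
    exact Finset.prod_eq_zero (Finset.mem_univ i) (image_eq_zero_of_notMem_tsupport hi)
  tsupport_subset' := fun _ _ => trivial

/-- The algebraic tensor product `⊗ⁿ 𝒟`, as a subspace of the test functions of `n` variables. -/
def algTensor (T : Type*) [NormedAddCommGroup T] [NormedSpace ℝ T] (n : ℕ) :
    Submodule ℝ (Test (Fin n → T)) :=
  Submodule.span ℝ (Set.range tensor)

/-- Permutation of the variables of a test function of `n` variables. -/
def permute {n : ℕ} (σ : Equiv.Perm (Fin n)) (ψ : Test (Fin n → T)) : Test (Fin n → T) where
  toFun x := ψ (x ∘ σ)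
  contDiff' := ψ.contDiff.comp (contDiff_pi.2 fun i => contDiff_apply ℝ T (σ i))
  hasCompactSupport' := ψ.hasCompactSupport.comp_homeomorph
    { toFun := fun x : Fin n → T => x ∘ σ
      invFun := fun x => x ∘ σ.symm
      left_inv := fun x => by ext; simp
      right_inv := fun x => by ext; simp
      continuous_toFun := by fun_prop
      continuous_invFun := by fun_prop }
  tsupport_subset' := fun _ _ => trivial

end Test

/-- The space `𝒟^∨ₙ'` of totally symmetric distributions of `n` variables, with its strong topology:
the topology on `StrongDual` is that of uniform convergence on bounded sets of test functions. -/
abbrev SymDist (T : Type*) [NormedAddCommGroup T] [NormedSpace ℝ T] (n : ℕ) :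
    Submodule ℝ (StrongDual ℝ (Test (Fin n → T))) where
  carrier := {ω | ∀ (σ : Equiv.Perm (Fin n)) ψ, ω (permute σ ψ) = ω ψ}
  add_mem' {ω₁ ω₂} h₁ h₂ σ ψ := by simp [h₁ σ ψ, h₂ σ ψ]
  zero_mem' _ _ := rfl
  smul_mem' c ω h σ ψ := by simp [h σ ψ]

/-- The weak topology on `𝒟^∨ₙ'` against `⊗ⁿ 𝒟`: the coarsest one for which `ω ↦ ω ψ` is continuous
for every `ψ ∈ ⊗ⁿ 𝒟`. -/
@[reducible]
def weakTensorTopology (T : Type*) [NormedAddCommGroup T] [NormedSpace ℝ T] (n : ℕ) :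
    TopologicalSpace (SymDist T n) :=
  TopologicalSpace.induced (fun (ω : SymDist T n) (ψ : algTensor T n) => ω.1 ψ.1)
    Pi.topologicalSpace

/-! ### Smooth functions -/

/-- The smooth real valued functions, as a set with its linear structure. -/
def smoothSubmodule (X : Type*) [NormedAddCommGroup X] [NormedSpace ℝ X] :
    Submodule ℝ (X → ℝ) where
  carrier := {φ | ContDiff ℝ ((⊤ : ℕ∞) : WithTop ℕ∞) φ}
  add_mem' h₁ h₂ := ContDiff.add (Set.mem_ofPred.1 h₁) (Set.mem_ofPred.1 h₂)
  zero_mem' := Set.mem_ofPred.2 contDiff_const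
  smul_mem' c _ h := ContDiff.const_smul c (Set.mem_ofPred.1 h)

/-- The space `ℰ(X)` of smooth real valued functions on `X`. -/
def Smooth (X : Type*) [NormedAddCommGroup X] [NormedSpace ℝ X] : Type _ := smoothSubmodule X

namespace Smooth

variable {X : Type*} [NormedAddCommGroup X] [NormedSpace ℝ X]

instance : AddCommGroup (Smooth X) := inferInstanceAs (AddCommGroup (smoothSubmodule X))

instance : Module ℝ (Smooth X) := inferInstanceAs (Module ℝ (smoothSubmodule X))

instance : CoeFun (Smooth X) (fun _ => X → ℝ) := ⟨Subtype.val⟩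

theorem contDiff (φ : Smooth X) : ContDiff ℝ ((⊤ : ℕ∞) : WithTop ℕ∞) φ := φ.2

/-- The `i`-th derivative of a smooth function, as a continuous function. -/
def deriv (i : ℕ) (φ : Smooth X) : C(X, X [×i]→L[ℝ] ℝ) where
  toFun := iteratedFDeriv ℝ i φ
  continuous_toFun := φ.contDiff.continuous_iteratedFDeriv (by exact_mod_cast le_top)

/-- The standard topology of `ℰ(X)`: locally uniform convergence of all derivatives. -/
instance : TopologicalSpace (Smooth X) :=
  ⨅ i : ℕ, TopologicalSpace.induced (deriv i) ContinuousMap.compactOpen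

end Smooth

/-- The subspace `ℰ^∨ₙ` of totally symmetric smooth functions of `n` variables, with the topology
induced by that of `ℰ`. -/
abbrev SymSmooth (T : Type*) [NormedAddCommGroup T] [NormedSpace ℝ T] (n : ℕ) :
    Submodule ℝ (Smooth (Fin n → T)) where
  carrier := {φ | ∀ (σ : Equiv.Perm (Fin n)) (x : Fin n → T), φ (x ∘ σ) = φ x}
  add_mem' h₁ h₂ σ x := congrArg₂ (· + ·) (h₁ σ x) (h₂ σ x)
  zero_mem' _ _ := rfl
  smul_mem' c _ h σ x := congrArg (c * ·) (h σ x)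

/-! ### Symmetric Wilsonian generalized functions -/

section W

variable {T : Type*} [NormedAddCommGroup T] [NormedSpace ℝ T] [FiniteDimensional ℝ T]
  [MeasurableSpace T] [BorelSpace T]

/-- The operator `⊗ⁿ C_h` on functions of `n` variables: convolution by `h` in every variable, that is
`(⊗ⁿ C_h φ)(x) = ∫ h(y₁) ⋯ h(yₙ) φ(x - y) dμ(y₁) ⋯ dμ(yₙ)`. -/
def tensorConv (μ : Measure T) {n : ℕ} (h : Test T) (φ : (Fin n → T) → ℝ) : (Fin n → T) → ℝ :=
  tensor (fun _ : Fin n => h) ⋆[ContinuousLinearMap.mul ℝ ℝ, Measure.pi fun _ => μ] φ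

theorem tensorConv_add (μ : Measure T) [μ.IsAddHaarMeasure] {n : ℕ} (h : Test T)
    (φ ψ : Smooth (Fin n → T)) :
    tensorConv μ h (⇑φ + ⇑ψ) = tensorConv μ h φ + tensorConv μ h ψ := by
  have key (χ : Smooth (Fin n → T)) : ConvolutionExists (tensor fun _ : Fin n => h) χ
      (ContinuousLinearMap.mul ℝ ℝ) (Measure.pi fun _ => μ) :=
    (tensor fun _ : Fin n => h).hasCompactSupport.convolutionExists_left _
      (tensor fun _ : Fin n => h).continuous χ.contDiff.continuous.locallyIntegrable
  exact (key φ).distrib_add (key ψ)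

/-- The space `W^∨ₙ` of `n`-variate symmetric Wilsonian generalized functions: the families
`(w(f))` of totally symmetric smooth functions, indexed by the nonzero test functions, with
`w(f) = ⊗ⁿ C_h w(g)` whenever `f = C_h g`. As a subspace of a product it carries the
projective limit topology, i.e. the coarsest one for which all `w ↦ w(f)` are continuous. -/
abbrev W (μ : Measure T) [μ.IsAddHaarMeasure] (n : ℕ) :
    Submodule ℝ ({f : Test T // f ≠ 0} → SymSmooth T n) where
  carrier := {w | ∀ (f g : {f : Test T // f ≠ 0}) (h : Test T), f.1 = conv μ h g.1 →
    ⇑(w f).1 = tensorConv μ h (w g).1}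
  add_mem' {w₁ w₂} h₁ h₂ f g h hf := by
    have e : ⇑((w₁ + w₂) f).1 = ⇑(w₁ f).1 + ⇑(w₂ f).1 := rfl
    have e' : ⇑((w₁ + w₂) g).1 = ⇑(w₁ g).1 + ⇑(w₂ g).1 := rfl
    rw [e, e', tensorConv_add, h₁ f g h hf, h₂ f g h hf]
  zero_mem' f g h _ := by
    have e (f : {f : Test T // f ≠ 0}) :
        ⇑((0 : {f : Test T // f ≠ 0} → SymSmooth T n) f).1 = 0 := rfl
    rw [e, e, tensorConv, convolution_zero]
  smul_mem' c w hw f g h hf := by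
    have e (f : {f : Test T // f ≠ 0}) : ⇑((c • w) f).1 = c • ⇑(w f).1 := rfl
    rw [e, e, tensorConv, convolution_smul, hw f g h hf, tensorConv]

variable {μ : Measure T} [μ.IsAddHaarMeasure] {n : ℕ}

open Classical in
/-- The canonical projection `Π_f w = w(f)`, extended by `Π_0 w = 0`. -/
def proj (f : Test T) (w : W μ n) : SymSmooth T n :=
  if h : f ≠ 0 then w.1 ⟨f, h⟩ else 0

/-- The polarized projection
`Π^∨_{f₁,…,fₙ} w = 1/n! ∑_{ε ∈ {0,1}ⁿ} (-1)^{n - ∑ εᵢ} Π_{∑ εᵢ fᵢ} w`; the sum over `ε` is written as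
a sum over the set `S` of those `i` with `εᵢ = 1`. -/
def polProj (f : Fin n → Test T) (w : W μ n) : SymSmooth T n :=
  (n.factorial : ℝ)⁻¹ •
    ∑ S : Finset (Fin n), (-1 : ℝ) ^ (n - S.card) • proj (∑ i ∈ S, f i) w

/-- The map `w̃ : 𝒟 × ⋯ × 𝒟 → ℝ`, `w̃(f₁, …, fₙ) = (Π^∨_{f₁ᵗ,…,fₙᵗ} w)(0)`. -/
def tilde (w : W μ n) (f : Fin n → Test T) : ℝ :=
  (polProj (fun i => reflect (f i)) w).1 0

end W

end Wilson

end

noncomputable section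

namespace Wilson

open scoped Distributions BoundedContinuousFunction SchwartzMap FourierTransform

/-! ### Seminorms on the space of test functions -/

section TestSeminorm

variable {X : Type*} [NormedAddCommGroup X] [NormedSpace ℝ X]

/-! The distribution is the limit of the smooth functions $w(\delta_j)$ along an approximate
identity $\delta_j$. Since convolution commutes, both $\otimes^n C_f\,w(\delta_j)$ and $\otimes^n
C_{\delta_j}w(f)$ equal $w(f\star\delta_j)$ as soon as $f\star\delta_j\ne0$, and the second tends
pointwise to $w(f)$. Evaluating at $0$ and polarizing, $\int (f_1\otimes\dots\otimes
f_n)\,w(\delta_j)\to\widetilde w(f_1,\dots,f_n)$ (`tendsto_pairing_tilde`). So $\widetilde w$ is a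
limit of symmetric multilinear forms, and its multilinearity needs no separate argument.

Passing from elementary tensors to all of $\mathcal D_n$ is a kernel theorem, obtained here by
Fourier analysis. The polynomials $f\mapsto\int f^{\otimes n}w(\delta_j)$ are pointwise bounded in
$j$; Baire's theorem in the complete space $\mathcal D_K$ and polarization about the Baire point
bound the multilinear forms uniformly (`exists_pairing_tensor_le`). Evaluated at cut-off plane
waves, these forms become symbols of polynomial growth in $\xi$, uniformly in $j$. Parseval's
formula writes $\int\psi\,w(\delta_j)$ as the integral of $\hat\psi$ against the symbol, and
dominated convergence yields the limit, with the symbol of $\widetilde w$, as well as its continuity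
in $\psi$ (`exists_symDist`).

Uniqueness holds because $\theta\star\delta_j^{\otimes n}$ is a superposition of elementary tensors
(`eq_zero_of_tensor_eq_zero`). For $n\ge1$, $k$ is injective since $w(f)(x)=\widetilde
w(f(x_1-\cdot),\dots,f(x_n-\cdot))$, and surjective since $f\mapsto(x\mapsto\omega(f^{\otimes
n}(x-\cdot)))$ is a preimage of $\omega$; that this lies in $W^\vee_n$ rests on a local Fourier
representation of distributions (`exists_eq_integral_hat`). For $n=0$ the convention $\Pi_0=0$ makes
$\widetilde w$ and $k$ vanish.

Weak continuity is clear, as $\widetilde w(f_1,\dots,f_n)$ is a finite combination of point values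
of $w$. For the strong topology, a convergent sequence with its limit is compact, so the symbol
bounds are uniform along it, while $\hat\psi$ has a common integrable majorant for $\psi$ in a
bounded set; dominated convergence finishes. -/

theorem continuous_iteratedFDeriv (i : ℕ) (f : Test X) : Continuous (iteratedFDeriv ℝ i f) :=
  f.contDiff.continuous_iteratedFDeriv (by exact_mod_cast le_top)

theorem bddAbove_iteratedFDeriv (i : ℕ) (f : Test X) :
    BddAbove (Set.range fun x => ‖iteratedFDeriv ℝ i f x‖) := by
  obtain ⟨C, hC⟩ := (f.hasCompactSupport.iteratedFDeriv i).exists_bound_of_continuous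
    (continuous_iteratedFDeriv i f)
  exact ⟨C, by rintro _ ⟨x, rfl⟩; exact hC x⟩

/-- The supremum norm of the `i`-th derivative of a test function. -/
def derivNorm (i : ℕ) (f : Test X) : ℝ := ⨆ x, ‖iteratedFDeriv ℝ i f x‖

theorem derivNorm_nonneg (i : ℕ) (f : Test X) : 0 ≤ derivNorm i f :=
  Real.iSup_nonneg fun _ => norm_nonneg _

theorem norm_iteratedFDeriv_le_derivNorm (i : ℕ) (f : Test X) (x : X) :
    ‖iteratedFDeriv ℝ i f x‖ ≤ derivNorm i f :=
  le_ciSup (bddAbove_iteratedFDeriv i f) x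

theorem derivNorm_le {i : ℕ} {f : Test X} {C : ℝ} (h : ∀ x, ‖iteratedFDeriv ℝ i f x‖ ≤ C) :
    derivNorm i f ≤ C :=
  ciSup_le h

/-- The `C^m` norm of a test function. -/
def cNorm (m : ℕ) (f : Test X) : ℝ := ∑ i ∈ Finset.range (m + 1), derivNorm i f

theorem cNorm_nonneg (m : ℕ) (f : Test X) : 0 ≤ cNorm m f :=
  Finset.sum_nonneg fun i _ => derivNorm_nonneg i f

theorem derivNorm_le_cNorm {i m : ℕ} (h : i ≤ m) (f : Test X) : derivNorm i f ≤ cNorm m f :=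
  Finset.single_le_sum (f := fun i => derivNorm i f) (fun i _ => derivNorm_nonneg i f)
    (by simpa [Nat.lt_succ_iff] using h)

theorem norm_iteratedFDeriv_le_cNorm {i m : ℕ} (h : i ≤ m) (f : Test X) (x : X) :
    ‖iteratedFDeriv ℝ i f x‖ ≤ cNorm m f :=
  (norm_iteratedFDeriv_le_derivNorm i f x).trans (derivNorm_le_cNorm h f)

theorem abs_le_cNorm (m : ℕ) (f : Test X) (x : X) : |f x| ≤ cNorm m f := by
  simpa using norm_iteratedFDeriv_le_cNorm (Nat.zero_le m) f x

theorem cNorm_le {m : ℕ} {f : Test X} {C : ℝ}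
    (h : ∀ i ≤ m, ∀ x, ‖iteratedFDeriv ℝ i f x‖ ≤ C) : cNorm m f ≤ (m + 1) * C := by
  refine (Finset.sum_le_card_nsmul (Finset.range (m + 1)) _ C fun i hi => ?_).trans (by simp)
  exact derivNorm_le (h i (by simpa [Nat.lt_succ_iff] using hi))

theorem cNorm_smul_le (m : ℕ) (c : ℝ) (f : Test X) : cNorm m (c • f) ≤ |c| * cNorm m f := by
  simp only [cNorm, Finset.mul_sum]
  refine Finset.sum_le_sum fun i _ => derivNorm_le fun x => ?_
  rw [show ⇑(c • f) = c • ⇑f from rfl, iteratedFDeriv_const_smul_apply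
    (f.contDiff.contDiffAt.of_le (by exact_mod_cast le_top)), norm_smul]
  exact mul_le_mul_of_nonneg_left (norm_iteratedFDeriv_le_derivNorm i f x) (abs_nonneg c)

theorem cNorm_add_le (m : ℕ) (f g : Test X) : cNorm m (f + g) ≤ cNorm m f + cNorm m g := by
  simp only [cNorm, ← Finset.sum_add_distrib]
  refine Finset.sum_le_sum fun i _ => derivNorm_le fun x => ?_
  rw [show ⇑(f + g) = ⇑f + ⇑g from rfl, iteratedFDeriv_add_apply
    (f.contDiff.contDiffAt.of_le (by exact_mod_cast le_top))
    (g.contDiff.contDiffAt.of_le (by exact_mod_cast le_top))]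
  exact (norm_add_le _ _).trans (add_le_add (norm_iteratedFDeriv_le_derivNorm i f x)
    (norm_iteratedFDeriv_le_derivNorm i g x))

theorem cNorm_zero (m : ℕ) : cNorm m (0 : Test X) = 0 :=
  le_antisymm (by simpa using cNorm_smul_le m 0 (0 : Test X)) (cNorm_nonneg _ _)

theorem cNorm_sum_le {ι : Type*} (m : ℕ) (s : Finset ι) (f : ι → Test X) :
    cNorm m (∑ j ∈ s, f j) ≤ ∑ j ∈ s, cNorm m (f j) :=
  Finset.le_sum_of_subadditive _ (cNorm_zero m).le (cNorm_add_le m) s f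

/-- A test function vanishing off `K`, as an element of `𝒟_K`. -/
def toSupportedIn (K : Compacts X) (f : Test X) (h : tsupport f ⊆ K) : 𝓓_{K}(X, ℝ) :=
  .of_support_subset f.contDiff (subset_closure.trans h)

theorem seminorm_eq_derivNorm (K : Compacts X) (f : 𝓓_{K}(X, ℝ)) (i : ℕ) :
    N[ℝ]_{K, i} f =
      derivNorm i (TestFunction.ofSupportedIn (Ω := ⊤) (fun _ _ => trivial) f) :=
  le_antisymm ((ContDiffMapSupportedIn.seminorm_top_le_iff ℝ (derivNorm_nonneg _ _) i f).2
    fun x _ => norm_iteratedFDeriv_le_derivNorm i (TestFunction.ofSupportedIn _ f) x)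
    (derivNorm_le fun _ => ContDiffMapSupportedIn.norm_iteratedFDeriv_apply_le_seminorm_top ℝ)

theorem sup_seminorm_le_cNorm (K : Compacts X) (f : 𝓓_{K}(X, ℝ)) {s : Finset ℕ} {m : ℕ}
    (hs : ∀ i ∈ s, i ≤ m) : (s.sup fun i => N[ℝ]_{K, i}) f ≤
      cNorm m (TestFunction.ofSupportedIn (Ω := ⊤) (fun _ _ => trivial) f) := by
  refine Seminorm.finset_sup_apply_le (cNorm_nonneg _ _) fun i hi => ?_
  rw [seminorm_eq_derivNorm]
  exact derivNorm_le_cNorm (hs i hi) _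

/-- A distribution has finite order on every compact set. -/
theorem exists_bound_of_compact (k : StrongDual ℝ (Test X)) {K : Set X} (hK : IsCompact K) :
    ∃ (m : ℕ) (C : ℝ), 0 ≤ C ∧ ∀ f : Test X, tsupport f ⊆ K → |k f| ≤ C * cNorm m f := by
  let K' : Compacts X := ⟨K, hK⟩
  let L : 𝓓_{K'}(X, ℝ) →L[ℝ] ℝ :=
    k.comp (TestFunction.ofSupportedInCLM ℝ (Ω := ⊤) (fun _ _ => trivial))
  obtain ⟨s, C, -, hC⟩ := Seminorm.bound_of_continuous
    (ContDiffMapSupportedIn.withSeminorms ℝ X ℝ ⊤ K') ((normSeminorm ℝ ℝ).comp L.toLinearMap)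
    (by exact L.continuous.norm)
  refine ⟨s.sup id, C, C.2, fun f hf => ?_⟩
  have h := hC (toSupportedIn K' f hf)
  refine (le_trans (by rfl) h).trans ?_
  exact mul_le_mul_of_nonneg_left (sup_seminorm_le_cNorm K' (toSupportedIn K' f hf)
    fun i hi => Finset.le_sup (f := id) hi) C.2

/-- A linear form on test functions of finite order on every compact set is continuous. -/
theorem continuous_of_bound {G : Type*} [NormedAddCommGroup G] [NormedSpace ℝ G]
    (k : Test X →ₗ[ℝ] G)
    (h : ∀ K : Set X, IsCompact K → ∃ (m : ℕ) (C : ℝ), 0 ≤ C ∧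
      ∀ f : Test X, tsupport f ⊆ K → ‖k f‖ ≤ C * cNorm m f) : Continuous k := by
  rw [TestFunction.continuous_iff_continuous_comp]
  intro K hK
  obtain ⟨m, C, hC, hb⟩ := h K K.isCompact
  refine (ContDiffMapSupportedIn.mkCLMtoNormedSpace ℝ
    (k ∘ TestFunction.ofSupportedIn hK) (fun f g => ?_) (fun c f => ?_)
    ⟨Finset.range (m + 1), C * (m + 1), by positivity, fun f => ?_⟩).continuous
  · exact k.map_add (TestFunction.ofSupportedIn hK f) (TestFunction.ofSupportedIn hK g)
  · exact k.map_smul c (TestFunction.ofSupportedIn hK f)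
  · refine (hb _ f.tsupport_subset).trans ?_
    rw [mul_assoc]
    refine mul_le_mul_of_nonneg_left ?_ hC
    refine (Finset.sum_le_card_nsmul _ _ ((Finset.range (m + 1)).sup
      (fun i => N[ℝ]_{K, i}) f) fun i hi => ?_).trans (by simp)
    have := seminorm_eq_derivNorm K f i
    exact this.symm.le.trans (Seminorm.le_finset_sup_apply hi)

end TestSeminorm

/-! ### Bounded sets of test functions -/

section Bounded

variable {X : Type*} [NormedAddCommGroup X] [NormedSpace ℝ X]

/-- Linear forms which are equicontinuous on every `𝒟_K` are uniformly bounded on bounded sets. -/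
theorem exists_bound_of_isVonNBounded {ι : Type*} (l : ι → Test X →ₗ[ℝ] ℝ)
    (hl : ∀ K : Set X, IsCompact K → ∃ (m : ℕ) (C : ℝ), 0 ≤ C ∧
      ∀ j, ∀ f : Test X, tsupport f ⊆ K → |l j f| ≤ C * cNorm m f)
    {B : Set (Test X)} (hB : Bornology.IsVonNBounded ℝ B) : ∃ C, ∀ f ∈ B, ∀ j, |l j f| ≤ C := by
  -- The forms are bundled into one continuous linear map to the bounded functions on the discrete
  -- space `ι`, which sends bounded sets to norm bounded sets.
  let _ : TopologicalSpace ι := ⊥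
  have : DiscreteTopology ι := ⟨rfl⟩
  have hbd (f : Test X) : ∃ C, ∀ j, ‖l j f‖ ≤ C := by
    obtain ⟨m, C, -, h⟩ := hl _ f.hasCompactSupport.isCompact
    exact ⟨_, fun j => h j f subset_rfl⟩
  let L : Test X →ₗ[ℝ] (ι →ᵇ ℝ) :=
    { toFun := fun f => BoundedContinuousFunction.ofNormedAddCommGroup (fun j => l j f)
        continuous_of_discreteTopology _ (hbd f).choose_spec
      map_add' := fun g₁ g₂ => by ext j; simp
      map_smul' := fun a g => by ext j; simp }
  have hcont : Continuous L := by
    refine continuous_of_bound L fun K hK => ?_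
    obtain ⟨m, C, hC, h⟩ := hl K hK
    exact ⟨m, C, hC, fun f hf => (BoundedContinuousFunction.norm_le
      (mul_nonneg hC (cNorm_nonneg _ _))).2 fun j => h j f hf⟩
  obtain ⟨C, hC⟩ := isBounded_iff_forall_norm_le.1 ((NormedSpace.isVonNBounded_iff ℝ).1
    (hB.image (⟨L, hcont⟩ : Test X →L[ℝ] (ι →ᵇ ℝ))))
  exact ⟨C, fun f hf j => ((L f).norm_coe_le_norm j).trans (hC _ (Set.mem_image_of_mem _ hf))⟩

/-- The norm of the derivative is a supremum of the linear forms $f\mapsto D^if(x)(v)/\prod\|v_j\|$,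
all dominated by the $C^i$ norm with constant $1$. When some $v_j=0$ the inverse is read as $0$,
which is harmless. -/
theorem exists_derivNorm_le_of_isVonNBounded {B : Set (Test X)}
    (hB : Bornology.IsVonNBounded ℝ B) (i : ℕ) : ∃ C, 0 ≤ C ∧ ∀ f ∈ B, derivNorm i f ≤ C := by
  obtain ⟨C, hC⟩ := exists_bound_of_isVonNBounded (ι := X × (Fin i → X)) (fun p =>
    { toFun := fun f => (∏ j, ‖p.2 j‖)⁻¹ * iteratedFDeriv ℝ i f p.1 p.2
      map_add' := fun f g => by
        rw [show ⇑(f + g) = ⇑f + ⇑g from rfl, iteratedFDeriv_add_apply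
          (f.contDiff.contDiffAt.of_le (by exact_mod_cast le_top))
          (g.contDiff.contDiffAt.of_le (by exact_mod_cast le_top)),
          add_apply, mul_add]
      map_smul' := fun c f => by
        rw [show ⇑(c • f) = c • ⇑f from rfl, iteratedFDeriv_const_smul_apply
          (f.contDiff.contDiffAt.of_le (by exact_mod_cast le_top)),
          smul_apply]
        simp only [smul_eq_mul, RingHom.id_apply]; ring })
    (fun K hK => ⟨i, 1, zero_le_one, fun p f _ => by
      rw [one_mul]
      refine le_trans ?_ (norm_iteratedFDeriv_le_cNorm le_rfl f p.1)
      have h := (iteratedFDeriv ℝ i f p.1).le_opNorm p.2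
      have h0 : 0 ≤ ∏ j, ‖p.2 j‖ := Finset.prod_nonneg fun _ _ => norm_nonneg _
      change |(∏ j, ‖p.2 j‖)⁻¹ * iteratedFDeriv ℝ i f p.1 p.2| ≤ _
      rw [abs_mul, abs_inv, abs_of_nonneg h0, inv_mul_eq_div]
      exact div_le_of_le_mul₀ h0 (norm_nonneg _) h⟩) hB
  refine ⟨|C|, abs_nonneg C, fun f hf => derivNorm_le fun x =>
    ContinuousMultilinearMap.opNorm_le_bound (abs_nonneg C) fun v => ?_⟩
  have h : |(∏ j, ‖v j‖)⁻¹ * iteratedFDeriv ℝ i f x v| ≤ C := hC f hf (x, v)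
  have h0 : 0 ≤ ∏ j, ‖v j‖ := Finset.prod_nonneg fun _ _ => norm_nonneg _
  rcases h0.eq_or_lt with h0 | h0
  · have := (iteratedFDeriv ℝ i f x).le_opNorm v
    rwa [← h0, mul_zero] at this ⊢
  · rw [abs_mul, abs_inv, abs_of_pos h0, inv_mul_eq_div, div_le_iff₀ h0] at h
    exact h.trans (mul_le_mul_of_nonneg_right (le_abs_self C) h0.le)

theorem exists_cNorm_le_of_isVonNBounded {B : Set (Test X)} (hB : Bornology.IsVonNBounded ℝ B)
    (m : ℕ) : ∃ C, 0 ≤ C ∧ ∀ f ∈ B, cNorm m f ≤ C := by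
  choose C hC0 hC using exists_derivNorm_le_of_isVonNBounded hB
  exact ⟨∑ i ∈ Finset.range (m + 1), C i, Finset.sum_nonneg fun i _ => hC0 i,
    fun f hf => Finset.sum_le_sum fun i _ => hC i f hf⟩

/-- The test functions of a bounded set are supported in a common ball. -/
theorem exists_tsupport_subset_of_isVonNBounded {B : Set (Test X)}
    (hB : Bornology.IsVonNBounded ℝ B) : ∃ R : ℝ, ∀ f ∈ B, tsupport f ⊆ Metric.closedBall 0 R := by
  by_contra! hcon
  have h (j : ℕ) : ∃ f ∈ B, ∃ x : X, (j : ℝ) < ‖x‖ ∧ f x ≠ 0 := by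
    by_contra! hj
    obtain ⟨f, hf, hfs⟩ := hcon j
    refine hfs (closure_minimal (fun x hx => ?_) Metric.isClosed_closedBall)
    by_contra hxj
    exact hx (hj f hf x (by simpa using hxj))
  choose f hf x hx hfx using h
  -- The points `x j` escape to infinity, so only finitely many forms $g\mapsto c_jg(x_j)$ are
  -- nonzero on any $\mathcal D_K$ and the family is equicontinuous there; yet the form takes the
  -- value $j$ on `f j`, against boundedness.
  let c (j : ℕ) : ℝ := j / f j (x j)
  obtain ⟨C, hC⟩ := exists_bound_of_isVonNBounded (fun j : ℕ =>
    { toFun := fun g : Test X => c j * g (x j)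
      map_add' := fun g₁ g₂ => by simp [mul_add]
      map_smul' := fun a g => by simp; ring }) (fun K hK => by
    obtain ⟨R, hR⟩ := hK.isBounded.subset_closedBall 0
    obtain ⟨N, hN⟩ := exists_nat_ge R
    have h0 : 0 ≤ ∑ j ∈ Finset.range N, |c j| := Finset.sum_nonneg fun _ _ => abs_nonneg _
    refine ⟨0, ∑ j ∈ Finset.range N, |c j|, h0, fun j g hg => ?_⟩
    change |c j * g (x j)| ≤ _
    rw [abs_mul]
    by_cases hj : j < N
    · exact mul_le_mul (Finset.single_le_sum (f := fun j => |c j|) (fun _ _ => abs_nonneg _)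
        (Finset.mem_range.2 hj)) (abs_le_cNorm _ _ _) (abs_nonneg _) h0
    · have : g (x j) = 0 := image_eq_zero_of_notMem_tsupport fun hmem => by
        have h1 : ‖x j‖ ≤ R := by simpa using hR (hg hmem)
        have h2 : (N : ℝ) ≤ j := by exact_mod_cast not_lt.1 hj
        linarith [hx j]
      rw [this, abs_zero, mul_zero]
      exact mul_nonneg h0 (cNorm_nonneg _ _)) hB
  obtain ⟨j, hj⟩ := exists_nat_gt C
  have h1 : |c j * f j (x j)| ≤ C := hC (f j) (hf j) j
  rw [div_mul_cancel₀ _ (hfx j), Nat.abs_cast] at h1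
  linarith

end Bounded

/-! ### Completeness of `𝒟_K` -/

section Complete

variable {X : Type*} [NormedAddCommGroup X] [NormedSpace ℝ X] (K : Compacts X)

/-- Allows completeness to be tested on sequences, and Baire's theorem to be applied. -/
instance : (uniformity 𝓓_{K}(X, ℝ)).IsCountablyGenerated :=
  (ContDiffMapSupportedIn.isUniformEmbedding_pi_structureMapCLM
    (E := X) (F := ℝ) (n := ⊤) (K := K) ℝ).comap_uniformity ▸
    inferInstance

instance : CompleteSpace 𝓓_{K}(X, ℝ) := by
  refine UniformSpace.complete_of_cauchySeq_tendsto fun f hf => ?_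
  have hc (i : ℕ) (ε : ℝ) (hε : 0 < ε) : ∃ N, ∀ a ≥ N, ∀ b ≥ N, ∀ x,
      ‖iteratedFDeriv ℝ i (f a) x - iteratedFDeriv ℝ i (f b) x‖ < ε := by
    have h0 : (ContDiffMapSupportedIn.seminorm ℝ X ℝ ⊤ K i).ball 0 ε ∈ 𝓝 (0 : 𝓓_{K}(X, ℝ)) :=
      Seminorm.ball_mem_nhds
        ((ContDiffMapSupportedIn.withSeminorms ℝ X ℝ ⊤ K).continuous_seminorm i) hε
    have h1 : (fun p : 𝓓_{K}(X, ℝ) × 𝓓_{K}(X, ℝ) => p.2 - p.1) ⁻¹'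
        (ContDiffMapSupportedIn.seminorm ℝ X ℝ ⊤ K i).ball 0 ε ∈ uniformity 𝓓_{K}(X, ℝ) := by
      rw [uniformity_eq_comap_nhds_zero]
      exact Filter.preimage_mem_comap h0
    obtain ⟨N, hN⟩ := cauchySeq_iff.1 hf _ h1
    refine ⟨N, fun a ha b hb x => ?_⟩
    have h2 := hN b hb a ha
    rw [Set.mem_preimage, Seminorm.mem_ball, sub_zero] at h2
    refine lt_of_le_of_lt ?_ h2
    have h3 := ContDiffMapSupportedIn.norm_iteratedFDeriv_apply_le_seminorm_top ℝ (i := i)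
      (f := f a - f b) (x := x)
    rwa [show ⇑(f a - f b) = ⇑(f a) - ⇑(f b) from rfl, iteratedFDeriv_sub_apply
      ((f a).contDiff.contDiffAt.of_le (by exact_mod_cast le_top))
      ((f b).contDiff.contDiffAt.of_le (by exact_mod_cast le_top))] at h3
  have hlim (i : ℕ) (x : X) : ∃ g, Filter.Tendsto (fun j => iteratedFDeriv ℝ i (f j) x)
      Filter.atTop (𝓝 g) := by
    refine cauchySeq_tendsto_of_complete (Metric.cauchySeq_iff.2 fun ε hε => ?_)
    obtain ⟨N, hN⟩ := hc i ε hε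
    exact ⟨N, fun a ha b hb => by rw [dist_eq_norm]; exact hN a ha b hb x⟩
  choose g happ using hlim
  have hunif (i : ℕ) : TendstoUniformly (fun j x => iteratedFDeriv ℝ i (f j) x) (g i)
      Filter.atTop := by
    rw [← tendstoUniformlyOn_univ]
    refine UniformCauchySeqOn.tendstoUniformlyOn_of_tendsto
      (Metric.uniformCauchySeqOn_iff.2 fun ε hε => ?_) fun x _ => happ i x
    obtain ⟨N, hN⟩ := hc i ε hε
    exact ⟨N, fun a ha b hb x _ => by rw [dist_eq_norm]; exact hN a ha b hb x⟩
  -- Derivatives pass to uniform limits, so the limits `g i` are the successive derivatives of the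
  -- first one.
  have hT : HasFTaylorSeriesUpTo ((⊤ : ℕ∞) : WithTop ℕ∞)
      (fun x => (g 0 x).curry0) (fun x i => g i x) := by
    refine ⟨fun x => rfl, fun i _ x => ?_, fun i _ => ?_⟩
    swap
    · exact (hunif i).continuous (Filter.Eventually.of_forall fun j =>
        (f j).contDiff.continuous_iteratedFDeriv (by exact_mod_cast le_top)).frequently
    have hu : TendstoUniformly (fun j x => (iteratedFDeriv ℝ (i + 1) (f j) x).curryLeft)
        (fun x => (g (i + 1) x).curryLeft) Filter.atTop := by
      exact UniformContinuous.comp_tendstoUniformly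
        (continuousMultilinearCurryLeftEquiv ℝ (fun _ : Fin (i + 1) => X)
          ℝ).isometry.uniformContinuous
        (hunif (i + 1))
    refine hasFDerivAt_of_tendstoUniformly hu (f := fun j x => iteratedFDeriv ℝ i (f j) x)
      (fun j y => ?_) (happ i) x
    exact (f j).contDiff.ftaylorSeries.fderiv i (by exact_mod_cast WithTop.coe_lt_top _) y
  have hsmooth : ContDiff ℝ ((⊤ : ℕ∞) : WithTop ℕ∞) (fun x => (g 0 x).curry0) := hT.contDiff
  let F : 𝓓_{K}(X, ℝ) := ⟨fun x => (g 0 x).curry0, hsmooth, fun x hx => by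
    have h0 : Filter.Tendsto (fun _ : ℕ => (0 : X [×0]→L[ℝ] ℝ)) Filter.atTop (𝓝 (g 0 x)) := by
      refine (happ 0 x).congr fun j => ?_
      rw [(f j).iteratedFDeriv_zero_on_compl hx]; rfl
    change (g 0 x).curry0 = 0
    rw [tendsto_nhds_unique h0 tendsto_const_nhds]; rfl⟩
  refine ⟨F, ((ContDiffMapSupportedIn.withSeminorms ℝ X ℝ ⊤ K).tendsto_nhds_atTop f F).2
    fun i ε hε => ?_⟩
  obtain ⟨N, hN⟩ := Metric.tendstoUniformly_iff.1 (hunif i) (ε / 2) (half_pos hε)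
    |> Filter.eventually_atTop.1
  refine ⟨N, fun j hj => lt_of_le_of_lt
    ((ContDiffMapSupportedIn.seminorm_top_le_iff ℝ (half_pos hε).le i _).2 fun x _ => ?_)
    (half_lt_self hε)⟩
  rw [show ⇑(f j - F) = ⇑(f j) - ⇑F from rfl, iteratedFDeriv_sub_apply
      ((f j).contDiff.contDiffAt.of_le (by exact_mod_cast le_top))
      (F.contDiff.contDiffAt.of_le (by exact_mod_cast le_top)), ← dist_eq_norm, dist_comm]
  refine le_of_eq_of_le ?_ (hN j hj x).le
  congr 1
  exact (hT.eq_iteratedFDeriv (m := i) (by exact_mod_cast le_top) x).symm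

end Complete

/-! ### The Fourier transform of a test function -/

section Fourier

variable {X : Type*} [NormedAddCommGroup X] [NormedSpace ℝ X]
  {E : Type*} [NormedAddCommGroup E] [InnerProductSpace ℝ E] (e : X ≃L[ℝ] E)

/-- A test function, transported to a Euclidean space and regarded as a Schwartz function. -/
def toSchwartz (ψ : Test X) : 𝓢(E, ℂ) :=
  HasCompactSupport.toSchwartzMap (f := fun y => (ψ (e.symm y) : ℂ))
    ((ψ.hasCompactSupport.comp_homeomorph e.symm.toHomeomorph).comp_left (g := Complex.ofReal) rfl)
    (Complex.ofRealCLM.contDiff.comp (ψ.contDiff.comp e.symm.contDiff))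

@[simp]
theorem toSchwartz_apply (ψ : Test X) (y : E) : toSchwartz e ψ y = (ψ (e.symm y) : ℂ) := rfl

theorem toSchwartz_add (ψ φ : Test X) : toSchwartz e (ψ + φ) = toSchwartz e ψ + toSchwartz e φ := by
  ext y; simp

theorem toSchwartz_smul (c : ℝ) (ψ : Test X) : toSchwartz e (c • ψ) = c • toSchwartz e ψ := by
  ext y; simp

theorem norm_iteratedFDeriv_comp_right_le {Y Z G : Type*} [NormedAddCommGroup Y] [NormedSpace ℝ Y]
    [NormedAddCommGroup Z] [NormedSpace ℝ Z] [NormedAddCommGroup G] [NormedSpace ℝ G]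
    (L : Y →L[ℝ] Z) {f : Z → G} {i : ℕ} (hf : ContDiff ℝ i f) (y : Y) :
    ‖iteratedFDeriv ℝ i (f ∘ L) y‖ ≤ ‖iteratedFDeriv ℝ i f (L y)‖ * ‖L‖ ^ i := by
  rw [L.iteratedFDeriv_comp_right hf y le_rfl]
  refine (ContinuousMultilinearMap.norm_compContinuousLinearMap_le _ _).trans ?_
  simp

theorem norm_iteratedFDeriv_toSchwartz_le (ψ : Test X) {i m : ℕ} (hi : i ≤ m) (y : E) :
    ‖iteratedFDeriv ℝ i (toSchwartz e ψ) y‖ ≤ cNorm m ψ * ‖(e.symm : E →L[ℝ] X)‖ ^ i := by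
  have h1 : ⇑(toSchwartz e ψ) = Complex.ofRealLI ∘ (ψ ∘ (e.symm : E →L[ℝ] X)) := rfl
  have h2 : ContDiff ℝ i ψ := ψ.contDiff.of_le (by exact_mod_cast le_top)
  rw [h1, Complex.ofRealLI.norm_iteratedFDeriv_comp_left
    (h2.comp (e.symm : E →L[ℝ] X).contDiff).contDiffAt le_rfl]
  exact (norm_iteratedFDeriv_comp_right_le _ h2 y).trans
    (mul_le_mul_of_nonneg_right (norm_iteratedFDeriv_le_cNorm hi ψ _) (by positivity))

variable [FiniteDimensional ℝ E] [MeasurableSpace E] [BorelSpace E]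

/-- The Fourier transform of a test function. -/
def hat (ψ : Test X) : 𝓢(E, ℂ) := 𝓕 (toSchwartz e ψ)

theorem hat_add (ψ φ : Test X) : hat e (ψ + φ) = hat e ψ + hat e φ := by
  rw [hat, toSchwartz_add, FourierTransform.fourier_add]; rfl

theorem hat_smul (c : ℝ) (ψ : Test X) : hat e (c • ψ) = c • hat e ψ := by
  rw [hat, toSchwartz_smul, FourierTransform.fourier_smul]; rfl

theorem fourierInv_hat (ψ : Test X) (x : X) :
    (ψ x : ℂ) = ∫ ξ, Complex.exp (↑(2 * Real.pi * inner ℝ ξ (e x)) * Complex.I) • hat e ψ ξ := by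
  rw [← Real.fourierInv_eq', ← SchwartzMap.fourierInv_coe, hat,
    FourierTransform.fourierInv_fourier_eq]
  simp

/-- Continuity of the Fourier transform on Schwartz space bounds the left side by finitely many
Schwartz seminorms of $\psi$; on functions supported in `K` their polynomial weights are bounded,
which leaves a $C^m$ norm. -/
theorem pow_mul_norm_hat_le (M : ℕ) {K : Set X} (hK : IsCompact K) :
    ∃ (m : ℕ) (C : ℝ), 0 ≤ C ∧ ∀ ψ : Test X, tsupport ψ ⊆ K →
      ∀ ξ, (1 + ‖ξ‖) ^ M * ‖hat e ψ ξ‖ ≤ C * cNorm m ψ := by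
  let q : Seminorm ℝ 𝓢(E, ℂ) := (2 ^ M : NNReal) • (Finset.Iic (M, 0)).sup
    (fun m : ℕ × ℕ => SchwartzMap.seminorm ℝ m.1 m.2)
  have hq : Continuous q := by
    exact Continuous.const_smul (Seminorm.continuous_finsetSup fun i _ =>
      (schwartz_withSeminorms ℝ E ℂ).continuous_seminorm i) _
  obtain ⟨s, C, -, hC⟩ := Seminorm.bound_of_continuous (schwartz_withSeminorms ℝ E ℂ)
    (q.comp (SchwartzMap.fourierTransformCLM ℝ : 𝓢(E, ℂ) →L[ℝ] 𝓢(E, ℂ)).toLinearMap)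
    (hq.comp (SchwartzMap.fourierTransformCLM ℝ).continuous)
  obtain ⟨R, hR⟩ := (hK.image e.continuous).isBounded.subset_closedBall 0
  let A (p : ℕ × ℕ) : ℝ := |R| ^ p.1 * ‖(e.symm : E →L[ℝ] X)‖ ^ p.2
  have hA (p : ℕ × ℕ) : 0 ≤ A p := by positivity
  refine ⟨s.sup Prod.snd, C * ∑ p ∈ s, A p, mul_nonneg C.2 (Finset.sum_nonneg fun p _ => hA p),
    fun ψ hψ ξ => ?_⟩
  have h1 := SchwartzMap.one_add_le_sup_seminorm_apply (𝕜 := ℝ) (m := (M, 0)) le_rfl le_rfl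
    (hat e ψ) ξ
  rw [norm_iteratedFDeriv_zero] at h1
  refine h1.trans ((hC (toSchwartz e ψ)).trans ?_)
  rw [mul_assoc]
  refine mul_le_mul_of_nonneg_left (Seminorm.finset_sup_apply_le (mul_nonneg
    (Finset.sum_nonneg fun p _ => hA p) (cNorm_nonneg _ _)) fun p hp => ?_) C.2
  have h2 : A p * cNorm (s.sup Prod.snd) ψ ≤ (∑ p ∈ s, A p) * cNorm (s.sup Prod.snd) ψ :=
    mul_le_mul_of_nonneg_right (Finset.single_le_sum (fun p _ => hA p) hp) (cNorm_nonneg _ _)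
  refine (SchwartzMap.seminorm_le_bound ℝ p.1 p.2 _ (mul_nonneg (hA p) (cNorm_nonneg _ _))
    fun y => ?_).trans h2
  by_cases hy : e.symm y ∈ K
  · have h3 : ‖y‖ ≤ |R| := by
      have := hR (Set.mem_image_of_mem e hy)
      simp only [ContinuousLinearEquiv.apply_symm_apply, mem_closedBall_zero_iff] at this
      exact this.trans (le_abs_self R)
    calc ‖y‖ ^ p.1 * ‖iteratedFDeriv ℝ p.2 (toSchwartz e ψ) y‖
        ≤ |R| ^ p.1 * (cNorm (s.sup Prod.snd) ψ * ‖(e.symm : E →L[ℝ] X)‖ ^ p.2) := by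
          gcongr
          exact norm_iteratedFDeriv_toSchwartz_le e ψ (Finset.le_sup (f := Prod.snd) hp) y
      _ = A p * cNorm (s.sup Prod.snd) ψ := by simp only [A]; ring
  · have h3 : iteratedFDeriv ℝ p.2 (toSchwartz e ψ) y = 0 := by
      refine image_eq_zero_of_notMem_tsupport fun hmem => hy ?_
      have h4 := tsupport_iteratedFDeriv_subset (𝕜 := ℝ) p.2 hmem
      have h5 : tsupport (toSchwartz e ψ) ⊆ e.symm ⁻¹' tsupport ψ := by
        refine closure_minimal (fun z hz => subset_closure ?_)
          ((isClosed_tsupport _).preimage e.symm.continuous)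
        simpa using hz
      exact hψ (h5 h4)
    rw [h3, norm_zero, mul_zero]
    exact mul_nonneg (hA p) (cNorm_nonneg _ _)

/-- The `C^m` norm of a test function is controlled by the moments of its Fourier transform. -/
theorem cNorm_le_integral_hat (m : ℕ) : ∃ C, 0 ≤ C ∧ ∀ (ψ : Test X) (A : ℝ),
    (∀ i ≤ m, ∫ ξ, ‖ξ‖ ^ i * ‖hat e ψ ξ‖ ≤ A) → cNorm m ψ ≤ C * A := by
  -- The added ones make the base at least $1$, so that this power serves all orders $i\le m$.
  let c : ℝ := ((1 + 2 * Real.pi * ‖innerSL ℝ (E := E)‖) * (1 + ‖(e : X →L[ℝ] E)‖)) ^ m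
  refine ⟨(m + 1) * c, by positivity, fun ψ A hA => ?_⟩
  rw [mul_assoc]
  refine cNorm_le fun i hi x => ?_
  have hA0 : 0 ≤ A := le_trans (integral_nonneg fun ξ => by positivity) (hA 0 (Nat.zero_le m))
  -- Writing $\psi=\mathcal F g$ allows differentiation under the integral sign;
  -- $|g(\xi)|=|\hat\psi(-\xi)|$ has the same moments.
  let g : 𝓢(E, ℂ) := 𝓕⁻ (toSchwartz e ψ)
  have hg (ξ : E) : ‖g ξ‖ = ‖hat e ψ (-ξ)‖ := by
    change ‖(𝓕⁻ (toSchwartz e ψ) : 𝓢(E, ℂ)) ξ‖ = ‖(𝓕 (toSchwartz e ψ) : 𝓢(E, ℂ)) (-ξ)‖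
    rw [SchwartzMap.fourierInv_coe, SchwartzMap.fourier_coe, Real.fourierInv_eq_fourier_neg]
  have hψ : ⇑(toSchwartz e ψ) = 𝓕 (g : E → ℂ) := by
    rw [← SchwartzMap.fourier_coe, FourierTransform.fourier_fourierInv_eq]
  have h1 : ‖iteratedFDeriv ℝ i ψ x‖ ≤
      ‖iteratedFDeriv ℝ i (toSchwartz e ψ) (e x)‖ * ‖(e : X →L[ℝ] E)‖ ^ i := by
    have h2 : Complex.ofRealLI ∘ ψ = toSchwartz e ψ ∘ (e : X →L[ℝ] E) := by
      ext y; simp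
    rw [← Complex.ofRealLI.norm_iteratedFDeriv_comp_left (n := i)
      (ψ.contDiff.of_le (by exact_mod_cast le_top)).contDiffAt le_rfl, h2]
    exact norm_iteratedFDeriv_comp_right_le _ ((toSchwartz e ψ).smooth i) x
  have h2 : ‖iteratedFDeriv ℝ i (toSchwartz e ψ) (e x)‖ ≤
      (2 * Real.pi * ‖innerSL ℝ (E := E)‖) ^ i * A := by
    rw [hψ, Real.iteratedFDeriv_fourier (N := ⊤)
      (fun n _ => g.integrable_pow_mul volume n) g.continuous.aestronglyMeasurable le_top]
    refine (VectorFourier.norm_fourierIntegral_le_integral_norm _ _ _ _ _).trans ?_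
    calc ∫ v, ‖VectorFourier.fourierPowSMulRight (innerSL ℝ) (⇑g) v i‖
        ≤ ∫ v, (2 * Real.pi * ‖innerSL ℝ (E := E)‖) ^ i * (‖v‖ ^ i * ‖g v‖) := by
          refine integral_mono_of_nonneg (Filter.Eventually.of_forall fun _ => norm_nonneg _)
            ((g.integrable_pow_mul volume i).const_mul _) (Filter.Eventually.of_forall fun v => ?_)
          exact (VectorFourier.norm_fourierPowSMulRight_le (innerSL ℝ) g v i).trans
            (le_of_eq (by ring))
      _ = (2 * Real.pi * ‖innerSL ℝ (E := E)‖) ^ i * ∫ v, ‖v‖ ^ i * ‖hat e ψ v‖ := by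
          rw [integral_const_mul]
          congr 1
          rw [← integral_neg_eq_self]
          simp [hg]
      _ ≤ _ := mul_le_mul_of_nonneg_left (hA i hi) (by positivity)
  calc ‖iteratedFDeriv ℝ i ψ x‖
      ≤ ((2 * Real.pi * ‖innerSL ℝ (E := E)‖) ^ i * A) * ‖(e : X →L[ℝ] E)‖ ^ i :=
        h1.trans (mul_le_mul_of_nonneg_right h2 (by positivity))
    _ = ((2 * Real.pi * ‖innerSL ℝ (E := E)‖) * ‖(e : X →L[ℝ] E)‖) ^ i * A := by
        rw [mul_pow]; ring
    _ ≤ c * A := by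
        refine mul_le_mul_of_nonneg_right ?_ hA0
        have h3 : 0 ≤ 2 * Real.pi * ‖innerSL ℝ (E := E)‖ := by positivity
        have h4 : 0 ≤ ‖(e : X →L[ℝ] E)‖ := by positivity
        refine (pow_le_pow_left₀ (mul_nonneg h3 h4) ?_ i).trans
          (pow_le_pow_right₀ ?_ hi) <;> nlinarith

end Fourier

/-! ### Local representation of distributions through the Fourier transform -/

section Representation

/-- A linear form bounded by the norm of a linear map factors through this map. -/
theorem exists_dual_comp_eq {V H : Type*} [AddCommGroup V] [Module ℝ V] [NormedAddCommGroup H]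
    [NormedSpace ℝ H] (J : V →ₗ[ℝ] H) (f : V →ₗ[ℝ] ℝ) (C : ℝ) (h : ∀ v, |f v| ≤ C * ‖J v‖) :
    ∃ l : StrongDual ℝ H, ∀ v, f v = l (J v) := by
  have hker : J.ker ≤ f.ker := fun v hv => by
    have := h v
    rw [LinearMap.mem_ker.1 hv, norm_zero, mul_zero] at this
    exact LinearMap.mem_ker.2 (abs_nonpos_iff.1 this)
  let f' : J.range →ₗ[ℝ] ℝ := (J.ker.liftQ f hker).comp J.quotKerEquivRange.symm.toLinearMap
  have hf' (v : V) : f' ⟨J v, LinearMap.mem_range_self J v⟩ = f v := by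
    have : J.quotKerEquivRange.symm ⟨J v, LinearMap.mem_range_self J v⟩ = J.ker.mkQ v := by
      rw [LinearEquiv.symm_apply_eq]; rfl
    simp [f', this]
  let F : StrongDual ℝ J.range := f'.mkContinuous C (by
    rintro ⟨_, v, rfl⟩
    have := h v
    rw [← hf' v] at this
    exact this)
  obtain ⟨l, hl, -⟩ := exists_extension_norm_eq J.range F
  exact ⟨l, fun v => ((hl ⟨J v, LinearMap.mem_range_self J v⟩).trans (hf' v)).symm⟩

variable {E : Type*} [NormedAddCommGroup E] [InnerProductSpace ℝ E]

/-- Multiplication of a Schwartz function by `(1 + ‖ξ‖²)^N`. -/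
def weight (N : ℕ) : 𝓢(E, ℂ) →L[ℝ] 𝓢(E, ℂ) :=
  SchwartzMap.smulLeftCLM ℂ (fun ξ : E => (1 + ‖ξ‖ ^ 2) ^ N)

theorem weight_apply (N : ℕ) (φ : 𝓢(E, ℂ)) (ξ : E) :
    weight N φ ξ = ((1 + ‖ξ‖ ^ 2) ^ N : ℝ) • φ ξ :=
  SchwartzMap.smulLeftCLM_apply_apply (by fun_prop) φ ξ

variable [FiniteDimensional ℝ E] [MeasurableSpace E] [BorelSpace E]

/-- Cauchy–Schwarz against $(1+\|\xi\|^2)^{-(d+1)}$, which is square integrable in dimension $d$. It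
replaces $C^m$ norms by a Hilbert space norm, so that Riesz's theorem becomes available. -/
theorem exists_integral_pow_mul_le (m : ℕ) : ∃ C, 0 ≤ C ∧ ∀ φ : 𝓢(E, ℂ), ∀ i ≤ m,
    ∫ ξ, ‖ξ‖ ^ i * ‖φ ξ‖ ≤ C * ‖(weight (m + (Module.finrank ℝ E + 1)) φ).toLp 2 volume‖ := by
  let r := Module.finrank ℝ E + 1
  let a : E → ℝ := fun ξ => ((1 + ‖ξ‖ ^ 2) ^ r)⁻¹
  have hac : Continuous a := Continuous.inv₀ (by fun_prop) fun ξ => by positivity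
  have ha : Integrable (fun ξ => a ξ ^ (2 : ℝ)) := by
    have := integrable_rpow_neg_one_add_norm_sq (E := E) (μ := volume) (r := 4 * r)
      (by simp only [r]; push_cast; linarith [(Nat.cast_nonneg (Module.finrank ℝ E) : (0:ℝ) ≤ _)])
    refine this.congr (Filter.Eventually.of_forall fun ξ => ?_)
    have h0 : (0 : ℝ) < 1 + ‖ξ‖ ^ 2 := by positivity
    simp only [a]
    rw [show -(4 * (r : ℝ)) / 2 = -((r * 2 : ℕ) : ℝ) by push_cast; ring, Real.rpow_neg h0.le,
      Real.rpow_natCast, pow_mul, Real.rpow_two, inv_pow]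
  refine ⟨(∫ ξ, a ξ ^ (2 : ℝ)) ^ (1 / (2 : ℝ)), by
    exact Real.rpow_nonneg (integral_nonneg fun ξ => by positivity) _, fun φ i hi => ?_⟩
  let W := weight (m + r) φ
  have ha2 : MemLp a (ENNReal.ofReal 2) volume := by
    rw [show ENNReal.ofReal 2 = 2 by norm_num]
    refine (memLp_two_iff_integrable_sq hac.aestronglyMeasurable).2 ?_
    simpa using ha
  have hW2 : MemLp (fun ξ => ‖W ξ‖) (ENNReal.ofReal 2) volume := by
    rw [show ENNReal.ofReal 2 = 2 by norm_num]
    exact (W.memLp 2 volume).norm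
  have h1 := integral_mul_le_Lp_mul_Lq_of_nonneg Real.HolderConjugate.two_two
    (Filter.Eventually.of_forall fun ξ => (by positivity : 0 ≤ a ξ))
    (Filter.Eventually.of_forall fun ξ => norm_nonneg (W ξ)) ha2 hW2
  have h2 : ‖W.toLp 2 volume‖ = (∫ ξ, ‖W ξ‖ ^ (2 : ℝ)) ^ (1 / (2 : ℝ)) := by
    rw [SchwartzMap.norm_toLp' (by simp) (by simp)]
    simp
  change _ ≤ _ * ‖W.toLp 2 volume‖
  rw [h2]
  refine le_trans (integral_mono_of_nonneg (Filter.Eventually.of_forall fun ξ => by positivity)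
    ?_ (Filter.Eventually.of_forall fun ξ => ?_)) h1
  · rw [show ENNReal.ofReal 2 = 2 by norm_num] at ha2 hW2
    exact ha2.integrable_mul hW2
  · have h0 : (1 : ℝ) ≤ 1 + ‖ξ‖ ^ 2 := by nlinarith [sq_nonneg ‖ξ‖]
    simp only [a, W, weight_apply, norm_smul]
    rw [Real.norm_of_nonneg (by positivity), pow_add _ m r, ← mul_assoc,
      mul_comm (((1 + ‖ξ‖ ^ 2) ^ r)⁻¹),
      mul_assoc ((1 + ‖ξ‖ ^ 2) ^ m), mul_inv_cancel₀ (by positivity), mul_one]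
    refine mul_le_mul_of_nonneg_right ?_ (norm_nonneg _)
    have h3 : ‖ξ‖ ≤ 1 + ‖ξ‖ ^ 2 := by nlinarith [sq_nonneg (‖ξ‖ - 1)]
    exact (pow_le_pow_left₀ (norm_nonneg ξ) h3 i).trans (pow_le_pow_right₀ h0 hi)

variable {X : Type*} [NormedAddCommGroup X] [NormedSpace ℝ X] (e : X ≃L[ℝ] E)

/-- On test functions with support in a given compact set, a distribution is integration of the
Fourier transform against a function of polynomial growth in the mean. -/
theorem exists_eq_integral_hat (k : StrongDual ℝ (Test X)) {K : Set X} (hK : IsCompact K) :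
    ∃ u : E → ℂ, (∀ φ : 𝓢(E, ℂ), Integrable fun ξ => u ξ * φ ξ) ∧
      ∀ ψ : Test X, tsupport ψ ⊆ K → k ψ = (∫ ξ, u ξ * hat e ψ ξ).re := by
  obtain ⟨m, C, hC, hk⟩ := exists_bound_of_compact k hK
  obtain ⟨C₁, hC₁, h₁⟩ := cNorm_le_integral_hat e m
  obtain ⟨C₂, hC₂, h₂⟩ := exists_integral_pow_mul_le (E := E) m
  let N := m + (Module.finrank ℝ E + 1)
  let V : Submodule ℝ (Test X) :=
    { carrier := {ψ | tsupport ψ ⊆ K}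
      add_mem' := fun {ψ φ} hψ hφ => (tsupport_add ψ φ).trans (Set.union_subset hψ hφ)
      zero_mem' := by
        change tsupport (fun _ : X => (0 : ℝ)) ⊆ K
        simp [tsupport]
      smul_mem' := fun c ψ hψ => (tsupport_smul_subset_right (fun _ => c) ψ).trans hψ }
  -- On functions supported in `K`, `k` is bounded by the $L^2$ norm of the weighted Fourier
  -- transform; it therefore extends by Hahn–Banach to $L^2$, where it is represented by some `v`.
  let J : V →ₗ[ℝ] Lp ℂ 2 (volume : Measure E) :=
    { toFun := fun ψ => (weight N (hat e ψ.1)).toLp 2 volume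
      map_add' := fun ψ φ => by
        rw [show ((ψ + φ : V) : Test X) = ψ.1 + φ.1 from rfl, hat_add, map_add]
        exact (SchwartzMap.toLpCLM ℝ ℂ 2 (volume : Measure E)).map_add _ _
      map_smul' := fun c ψ => by
        rw [show ((c • ψ : V) : Test X) = c • ψ.1 from rfl, hat_smul, map_smul]
        exact (SchwartzMap.toLpCLM ℝ ℂ 2 (volume : Measure E)).map_smul c _ }
  obtain ⟨l, hl⟩ := exists_dual_comp_eq J (k.toLinearMap ∘ₗ V.subtype) (C * (C₁ * C₂)) (by
    rintro ⟨ψ, hψ⟩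
    refine (hk ψ hψ).trans ?_
    rw [mul_assoc, mul_assoc]
    exact mul_le_mul_of_nonneg_left (h₁ ψ _ fun i hi => h₂ (hat e ψ) i hi) hC)
  let v : Lp ℂ 2 (volume : Measure E) :=
    (InnerProductSpace.toDual ℝ (Lp ℂ 2 (volume : Measure E))).symm l
  have hv (φ : Lp ℂ 2 (volume : Measure E)) : l φ = ∫ ξ, inner ℝ (v ξ) (φ ξ) := by
    rw [← L2.inner_def, InnerProductSpace.toDual_symm_apply]
  -- The real inner product on $\mathbb C$ is $\mathrm{Re}(\bar v\varphi)$; the weight is moved from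
  -- the test function to `u`.
  let u : E → ℂ := fun ξ => (starRingEnd ℂ (v ξ)) * ((1 + ‖ξ‖ ^ 2) ^ N : ℝ)
  have hu (φ : 𝓢(E, ℂ)) (ξ : E) : u ξ * φ ξ = (starRingEnd ℂ (v ξ)) * weight N φ ξ := by
    rw [weight_apply]
    simp only [u, Complex.real_smul]
    ring
  have h_int (φ : 𝓢(E, ℂ)) : Integrable fun ξ => u ξ * φ ξ := by
    simp_rw [hu]
    exact MemLp.integrable_mul (p := 2) (q := 2) (Lp.memLp v).star ((weight N φ).memLp 2 volume)
  refine ⟨u, h_int, fun ψ hψ => ?_⟩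
  have h3 : k ψ = l (J ⟨ψ, hψ⟩) := hl ⟨ψ, hψ⟩
  rw [h3, hv]
  change _ = RCLike.re (∫ ξ, u ξ * hat e ψ ξ)
  rw [← integral_re (h_int _)]
  refine integral_congr_ae ?_
  filter_upwards [SchwartzMap.coeFn_toLp (weight N (hat e ψ)) 2 volume] with ξ hξ
  change inner ℝ (v ξ) ((weight N (hat e ψ)).toLp 2 volume ξ) = _
  rw [hξ, hu, Complex.inner, mul_comm]
  rfl

end Representation

/-! ### Convolution of a distribution with a test function -/

section Regularization

variable {X : Type*} [NormedAddCommGroup X] [NormedSpace ℝ X]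

/-- The test function `y ↦ ψ(x - y)`. -/
def subFrom (x : X) (ψ : Test X) : Test X where
  toFun y := ψ (x - y)
  contDiff' := ψ.contDiff.comp (contDiff_const.sub contDiff_id)
  hasCompactSupport' := ψ.hasCompactSupport.comp_homeomorph (Homeomorph.subLeft x)
  tsupport_subset' := fun _ _ => trivial

@[simp]
theorem subFrom_apply (x : X) (ψ : Test X) (y : X) : subFrom x ψ y = ψ (x - y) := rfl

theorem tsupport_subFrom_subset (x : X) (ψ : Test X) :
    tsupport (subFrom x ψ) ⊆ (fun p : X × X => p.1 - p.2) '' ({x} ×ˢ tsupport ψ) := by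
  have hc : IsCompact ((fun p : X × X => p.1 - p.2) '' ({x} ×ˢ tsupport ψ)) :=
    (isCompact_singleton.prod ψ.hasCompactSupport).image (by fun_prop)
  refine closure_minimal (fun y hy => ?_) hc.isClosed
  exact ⟨(x, x - y), ⟨rfl, subset_closure hy⟩, by simp⟩

variable {E : Type*} [NormedAddCommGroup E] [InnerProductSpace ℝ E] [FiniteDimensional ℝ E]
  [MeasurableSpace E] [BorelSpace E] (e : X ≃L[ℝ] E)

/-- Reflection turns the transform into its inverse and translation produces a phase, which carries
the whole dependence on `x`. -/
theorem hat_subFrom (x : X) (ψ : Test X) (ξ : E) :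
    hat e (subFrom x ψ) ξ =
      Complex.exp (↑(-2 * Real.pi * inner ℝ ξ (e x)) * Complex.I) •
        (𝓕⁻ (toSchwartz e ψ) : 𝓢(E, ℂ)) ξ := by
  rw [hat, SchwartzMap.fourier_coe, SchwartzMap.fourierInv_coe, Real.fourier_eq',
    Real.fourierInv_eq', ← integral_smul, ← integral_sub_left_eq_self _ _ (e x)]
  refine integral_congr_ae (Filter.Eventually.of_forall fun v => ?_)
  simp only [toSchwartz_apply, subFrom_apply, map_sub, ContinuousLinearEquiv.symm_apply_apply,
    sub_sub_cancel, smul_smul, ← Complex.exp_add]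
  congr 2
  rw [inner_sub_left, real_inner_comm ξ (e x)]
  push_cast
  ring

/-- The family `x ↦ k(ψ(x - ·))` is locally a Fourier integral. -/
theorem exists_eq_fourier (k : StrongDual ℝ (Test X)) (ψ : Test X) {S : Set X} (hS : IsCompact S) :
    ∃ g : E → ℂ, (∀ n : ℕ, Integrable fun ξ => ‖ξ‖ ^ n * ‖g ξ‖) ∧ Integrable g ∧
      ∀ x ∈ S, k (subFrom x ψ) = (𝓕 g (e x)).re := by
  have hK : IsCompact ((fun p : X × X => p.1 - p.2) '' (S ×ˢ tsupport ψ)) :=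
    (hS.prod ψ.hasCompactSupport).image (by fun_prop)
  obtain ⟨u, hu, hk⟩ := exists_eq_integral_hat e k hK
  let h : 𝓢(E, ℂ) := 𝓕⁻ (toSchwartz e ψ)
  refine ⟨fun ξ => u ξ * h ξ, fun n => ?_, hu h, fun x hx => ?_⟩
  · refine (hu (weight n h)).norm.mono ?_ (Filter.Eventually.of_forall fun ξ => ?_)
    · exact (by fun_prop : Continuous fun ξ : E => ‖ξ‖ ^ n).aestronglyMeasurable.mul
        (hu h).aestronglyMeasurable.norm
    · simp only [norm_mul, norm_pow, norm_norm, weight_apply, norm_smul]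
      rw [Real.norm_of_nonneg (by positivity : (0 : ℝ) ≤ 1 + ‖ξ‖ ^ 2)]
      have h3 : ‖ξ‖ ≤ 1 + ‖ξ‖ ^ 2 := by nlinarith [sq_nonneg (‖ξ‖ - 1)]
      calc ‖ξ‖ ^ n * (‖u ξ‖ * ‖h ξ‖) ≤ (1 + ‖ξ‖ ^ 2) ^ n * (‖u ξ‖ * ‖h ξ‖) := by gcongr
        _ = _ := by ring
  · rw [hk _ ((tsupport_subFrom_subset x ψ).trans
      (Set.image_mono (Set.prod_mono_left (Set.singleton_subset_iff.2 hx)))), Real.fourier_eq']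
    congr 2
    ext ξ
    rw [hat_subFrom]
    simp only [smul_eq_mul]
    ring

variable [FiniteDimensional ℝ X]

/-- The convolution of a distribution with a test function is smooth. -/
theorem contDiff_subFrom (k : StrongDual ℝ (Test X)) (ψ : Test X) :
    ContDiff ℝ ((⊤ : ℕ∞) : WithTop ℕ∞) fun x => k (subFrom x ψ) := by
  let e : X ≃L[ℝ] EuclideanSpace ℝ (Fin (Module.finrank ℝ X)) := toEuclidean
  have := FiniteDimensional.proper ℝ X
  rw [contDiff_iff_contDiffAt]
  intro x
  obtain ⟨g, hg, -, hk⟩ := exists_eq_fourier e k ψ (isCompact_closedBall x 1)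
  have h1 : ContDiff ℝ ((⊤ : ℕ∞) : WithTop ℕ∞) fun x => (𝓕 g (e x)).re :=
    Complex.reCLM.contDiff.comp ((Real.contDiff_fourier fun n _ => hg n).comp e.contDiff)
  refine h1.contDiffAt.congr_of_eventuallyEq ?_
  filter_upwards [Metric.closedBall_mem_nhds x one_pos] with y hy using hk y hy

variable [MeasurableSpace X] [BorelSpace X] (ν : Measure X) [ν.IsAddHaarMeasure]

theorem conv_apply (θ ψ : Test X) (x : X) : conv ν θ ψ x = ∫ z, θ z * ψ (x - z) ∂ν := rfl

theorem conv_comm (θ ψ : Test X) : conv ν θ ψ = conv ν ψ θ := by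
  ext x
  rw [conv_apply, conv_apply, ← integral_sub_left_eq_self _ _ x]
  simp [mul_comm]

/-- The convolution theorem. The factor of $\theta$ stays an integral against $\nu$, so the
normalization of $\nu$ relative to the volume of `E` never enters. -/
theorem fourierInv_conv (θ ψ : Test X) (ξ : E) :
    (𝓕⁻ (toSchwartz e (conv ν θ ψ)) : 𝓢(E, ℂ)) ξ =
      (∫ z, Complex.exp (↑(2 * Real.pi * inner ℝ (e z) ξ) * Complex.I) * θ z ∂ν) *
        (𝓕⁻ (toSchwartz e ψ) : 𝓢(E, ℂ)) ξ := by
  have := FiniteDimensional.proper ℝ X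
  simp only [SchwartzMap.fourierInv_coe, Real.fourierInv_eq', toSchwartz_apply, conv_apply]
  have h1 (z : X) : Complex.exp (↑(2 * Real.pi * inner ℝ (e z) ξ) * Complex.I) * θ z *
      ∫ v, Complex.exp (↑(2 * Real.pi * inner ℝ v ξ) * Complex.I) • (ψ (e.symm v) : ℂ) =
      ∫ v, Complex.exp (↑(2 * Real.pi * inner ℝ v ξ) * Complex.I) *
        (θ z * ψ (e.symm v - z) : ℝ) := by
    rw [← integral_const_mul, ← integral_sub_right_eq_self _ (e z)]
    refine integral_congr_ae (Filter.Eventually.of_forall fun v => ?_)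
    simp only [smul_eq_mul, map_sub, ContinuousLinearEquiv.symm_apply_apply]
    rw [show Complex.exp (↑(2 * Real.pi * inner ℝ v ξ) * Complex.I) =
      Complex.exp (↑(2 * Real.pi * inner ℝ (e z) ξ) * Complex.I) *
        Complex.exp (↑(2 * Real.pi * inner ℝ (v - e z) ξ) * Complex.I) by
      rw [← Complex.exp_add, inner_sub_left]
      congr 1
      push_cast
      ring]
    push_cast
    ring
  rw [← integral_mul_const]
  simp_rw [h1]
  rw [integral_integral_swap]
  · refine integral_congr_ae (Filter.Eventually.of_forall fun v => ?_)
    simp only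
    rw [integral_const_mul, integral_complex_ofReal, smul_eq_mul]
  · refine Continuous.integrable_of_hasCompactSupport ?_ ?_
    · have hθ := θ.continuous
      have hψ := ψ.continuous
      simp only [Function.uncurry_def]
      fun_prop
    · have hK : IsCompact (tsupport θ ×ˢ
          (e '' ((fun p : X × X => p.1 + p.2) '' (tsupport θ ×ˢ tsupport ψ)))) :=
        θ.hasCompactSupport.isCompact.prod (((θ.hasCompactSupport.isCompact.prod
          ψ.hasCompactSupport).image (by fun_prop)).image e.continuous)
      refine HasCompactSupport.intro hK ?_
      rintro ⟨z, v⟩ hzv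
      simp only [Function.uncurry_apply_pair]
      by_contra hne
      refine hzv ?_
      have h2 : θ z ≠ 0 := fun h => hne (by simp [h])
      have h3 : ψ (e.symm v - z) ≠ 0 := fun h => hne (by simp [h])
      exact ⟨subset_closure h2, e.symm v,
        ⟨(z, e.symm v - z), ⟨subset_closure h2, subset_closure h3⟩,
        by simp⟩, by simp⟩

/-- Applying a distribution commutes with convolution by a test function. -/
theorem integral_mul_subFrom (k : StrongDual ℝ (Test X)) (θ ψ : Test X) (x : X) :
    ∫ z, θ z * k (subFrom (x - z) ψ) ∂ν = k (subFrom x (conv ν θ ψ)) := by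
  have := FiniteDimensional.proper ℝ X
  let e : X ≃L[ℝ] EuclideanSpace ℝ (Fin (Module.finrank ℝ X)) := toEuclidean
  have hS : IsCompact ((fun z => x - z) '' tsupport θ) :=
    θ.hasCompactSupport.isCompact.image (by fun_prop)
  have hK₁ : IsCompact ((fun p : X × X => p.1 - p.2) ''
      (((fun z => x - z) '' tsupport θ) ×ˢ tsupport ψ)) :=
    (hS.prod ψ.hasCompactSupport).image (by fun_prop)
  -- One compact set, and hence one `u`, serves the translates under the integral and the
  -- convolution; the claim is then Fubini's theorem.
  obtain ⟨u, hu, hk⟩ := exists_eq_integral_hat e k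
    (hK₁.union (subFrom x (conv ν θ ψ)).hasCompactSupport.isCompact)
  let h : 𝓢(EuclideanSpace ℝ (Fin (Module.finrank ℝ X)), ℂ) := 𝓕⁻ (toSchwartz e ψ)
  have hl (z : X) : θ z * k (subFrom (x - z) ψ) = (∫ ξ, (θ z : ℂ) *
      (Complex.exp (↑(-2 * Real.pi * inner ℝ ξ (e (x - z))) * Complex.I) * (u ξ * h ξ))).re := by
    by_cases hz : z ∈ tsupport θ
    · rw [hk _ (Set.subset_union_of_subset_left ((tsupport_subFrom_subset _ ψ).trans
        (Set.image_mono (Set.prod_mono_left (Set.singleton_subset_iff.2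
          (Set.mem_image_of_mem (fun z => x - z) hz))))) _),
        integral_const_mul, Complex.re_ofReal_mul]
      congr 3
      ext ξ
      rw [hat_subFrom, smul_eq_mul]
      ring
    · simp [image_eq_zero_of_notMem_tsupport hz]
  have h_int : Integrable (Function.uncurry fun z ξ => (θ z : ℂ) *
      (Complex.exp (↑(-2 * Real.pi * inner ℝ ξ (e (x - z))) * Complex.I) * (u ξ * h ξ)))
      (ν.prod volume) := by
    have h1 : Integrable (fun p : X × EuclideanSpace ℝ (Fin (Module.finrank ℝ X)) =>
        (θ p.1 : ℂ) * (u p.2 * h p.2)) (ν.prod volume) :=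
      (θ.continuous.integrable_of_hasCompactSupport θ.hasCompactSupport).ofReal.mul_prod (hu h)
    have h2 : Continuous fun p : X × EuclideanSpace ℝ (Fin (Module.finrank ℝ X)) =>
        Complex.exp (↑(-2 * Real.pi * inner ℝ p.2 (e (x - p.1))) * Complex.I) := by fun_prop
    refine (h1.bdd_mul h2.aestronglyMeasurable (c := 1)
      (Filter.Eventually.of_forall fun p => ?_)).congr
      (Filter.Eventually.of_forall fun p => ?_)
    · rw [Complex.norm_exp_ofReal_mul_I]
    · simp only [Function.uncurry_def]; ring
  simp_rw [hl]
  refine (integral_re h_int.integral_prod_left).trans ?_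
  rw [hk _ Set.subset_union_right]
  refine (congrArg Complex.re (integral_integral_swap h_int)).trans ?_
  congr 2
  ext ξ
  have h3 (a b c d : ℂ) : a * (b * (c * d)) = c * (b * (a * d)) := by ring
  rw [hat_subFrom, fourierInv_conv, smul_eq_mul, h3, ← integral_mul_const]
  refine integral_congr_ae (Filter.Eventually.of_forall fun z => ?_)
  simp only
  rw [map_sub, inner_sub_right, real_inner_comm (e z) ξ,
    show (↑(-2 * Real.pi * (inner ℝ ξ (e x) - inner ℝ (e z) ξ)) * Complex.I : ℂ) =
      ↑(2 * Real.pi * inner ℝ (e z) ξ) * Complex.I +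
        ↑(-2 * Real.pi * inner ℝ ξ (e x)) * Complex.I by
    push_cast; ring, Complex.exp_add]
  ring

end Regularization

/-! ### Polarization -/

section Polarization

/-- After complementation this is the alternating sum over the subsets of $R^c$, which vanishes
unless $R^c$ is empty. -/
theorem sum_neg_one_pow_of_superset {n : ℕ} (R : Finset (Fin n)) :
    ∑ S : Finset (Fin n), (-1 : ℝ) ^ (n - S.card) * (if R ⊆ S then 1 else 0) =
      if R = Finset.univ then 1 else 0 := by
  have h1 : ∑ S : Finset (Fin n), (-1 : ℝ) ^ (n - S.card) * (if R ⊆ S then 1 else 0) =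
      ∑ S : Finset (Fin n), if S ⊆ Rᶜ then (-1 : ℝ) ^ S.card else 0 := by
    refine Fintype.sum_equiv (Equiv.ofBijective compl compl_bijective) _ _ fun S => ?_
    simp only [Equiv.ofBijective_apply, Finset.card_compl, Fintype.card_fin,
      Finset.compl_subset_compl]
    split_ifs <;> simp
  have h2 := congrArg (Int.cast : ℤ → ℝ) (Finset.sum_powerset_neg_one_pow_card (x := Rᶜ))
  rw [h1, ← Finset.sum_filter]
  have h3 : (Finset.univ.filter fun S => S ⊆ Rᶜ) = Rᶜ.powerset := by ext S; simp
  rw [h3]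
  push_cast at h2
  rw [h2]
  simp [Finset.compl_eq_empty_iff]

/-- The polarization identity, with an arbitrary base point. -/
theorem polarization {n : ℕ} (c : Fin n → ℝ) (a : Fin n → Fin n → ℝ) :
    ∑ S : Finset (Fin n), (-1 : ℝ) ^ (n - S.card) * ∏ i, (c i + ∑ j ∈ S, a j i) =
      ∑ σ : Equiv.Perm (Fin n), ∏ i, a (σ i) i := by
  classical
  -- Expanding the product, each factor $i$ selects the base point (`none`) or some $a_{ji}$ (`some
  -- j`). The alternating sum keeps only selections that use every $j$; with $n$ slots these are the
  -- permutations, and `none` cannot occur.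
  let b : Option (Fin n) → Fin n → ℝ := fun o i => o.elim (c i) fun j => a j i
  let R : (Fin n → Option (Fin n)) → Finset (Fin n) := fun τ =>
    Finset.univ.filter fun j => ∃ i, τ i = some j
  have h1 (S : Finset (Fin n)) (i : Fin n) : c i + ∑ j ∈ S, a j i =
      ∑ o : Option (Fin n), if (∀ j, o = some j → j ∈ S) then b o i else 0 := by
    rw [Fintype.sum_option]
    simp [b]
  have h2 (S : Finset (Fin n)) : ∏ i, (c i + ∑ j ∈ S, a j i) =
      ∑ τ : Fin n → Option (Fin n), (∏ i, b (τ i) i) * (if R τ ⊆ S then 1 else 0) := by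
    simp_rw [h1]
    rw [Finset.prod_univ_sum, Fintype.piFinset_univ]
    refine Finset.sum_congr rfl fun τ _ => ?_
    rw [mul_ite, mul_one, mul_zero, Finset.prod_ite_zero]
    congr 1
    simp only [R, Finset.subset_iff, Finset.mem_filter, Finset.mem_univ, true_and, forall_const,
      forall_exists_index]
    exact propext forall_comm
  simp_rw [h2, Finset.mul_sum]
  rw [Finset.sum_comm]
  have h3 (τ : Fin n → Option (Fin n)) : ∑ S : Finset (Fin n), (-1 : ℝ) ^ (n - S.card) *
      ((∏ i, b (τ i) i) * (if R τ ⊆ S then 1 else 0)) =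
      (∏ i, b (τ i) i) * if R τ = Finset.univ then 1 else 0 := by
    rw [← sum_neg_one_pow_of_superset, Finset.mul_sum]
    exact Finset.sum_congr rfl fun S _ => by ring
  simp_rw [h3]
  symm
  refine Fintype.sum_of_injective (fun (σ : Equiv.Perm (Fin n)) i => some (σ i)) (fun σ σ' h => ?_)
    _ _ (fun τ hτ => ?_) fun σ => ?_
  · ext i
    have := congrFun h i
    simp only [Option.some.injEq] at this
    rw [this]
  · rw [if_neg, mul_zero]
    intro hR
    refine hτ ?_
    have h4 (j : Fin n) : ∃ i, τ i = some j := by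
      have : j ∈ R τ := hR ▸ Finset.mem_univ j
      simpa [R] using this
    choose s hs using h4
    have hinj : Function.Injective s := fun j j' h => by
      have := hs j
      rw [h, hs j'] at this
      exact (Option.some.inj this).symm
    let σ := Equiv.ofBijective s (Finite.injective_iff_bijective.1 hinj)
    refine ⟨σ.symm, funext fun i => ?_⟩
    have := hs (σ.symm i)
    rw [show s (σ.symm i) = i from σ.apply_symm_apply i] at this
    exact this.symm
  · rw [if_pos, mul_one]
    · rfl
    · ext j
      simp only [R, Finset.mem_filter, Finset.mem_univ, true_and, iff_true, Option.some.injEq]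
      exact ⟨σ.symm j, σ.apply_symm_apply j⟩

end Polarization

/-! ### Elementary tensors and their translates -/

section Tensor

variable {T : Type*} [NormedAddCommGroup T] [NormedSpace ℝ T] {n : ℕ}

theorem tensor_apply (f : Fin n → Test T) (x : Fin n → T) : tensor f x = ∏ i, f i (x i) := rfl

theorem subFrom_tensor (f : Fin n → Test T) (x : Fin n → T) :
    subFrom x (tensor f) = tensor fun i => subFrom (x i) (f i) := rfl

end Tensor

/-! ### Approximate identities -/

section Mollifier

variable {T : Type*} [NormedAddCommGroup T] [NormedSpace ℝ T] [FiniteDimensional ℝ T]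
  [MeasurableSpace T] [BorelSpace T] (μ : Measure T) [μ.IsAddHaarMeasure]

/-- A nonnegative test function of integral one supported in the ball of radius `1 / (j + 1)`. -/
def mollifier (j : ℕ) : Test T :=
  let b : ContDiffBump (0 : T) := ⟨1 / (j + 2), 1 / (j + 1), by positivity, by gcongr; norm_num⟩
  { toFun := b.normed μ
    contDiff' := b.contDiff_normed
    hasCompactSupport' := b.hasCompactSupport_normed
    tsupport_subset' := fun _ _ => trivial }

theorem mollifier_nonneg (j : ℕ) (x : T) : 0 ≤ mollifier μ j x :=
  ContDiffBump.nonneg_normed _ x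

theorem integral_mollifier (j : ℕ) : ∫ x, mollifier μ j x ∂μ = 1 :=
  ContDiffBump.integral_normed _

theorem norm_lt_of_mollifier_ne_zero {j : ℕ} {x : T} (h : mollifier μ j x ≠ 0) :
    ‖x‖ < 1 / (j + 1) := by
  have h1 : x ∈ Function.support (mollifier μ j) := h
  rw [show Function.support (mollifier μ j) = Metric.ball 0 (1 / ((j : ℝ) + 1)) from
    ContDiffBump.support_normed_eq _] at h1
  simpa using h1

theorem mollifier_ne_zero (j : ℕ) : mollifier μ j ≠ 0 := fun h => by
  have := integral_mollifier μ j
  rw [h] at this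
  simp at this

theorem tendsto_integral_mul_of_shrinking {X : Type*} [NormedAddCommGroup X] [NormedSpace ℝ X]
    [FiniteDimensional ℝ X] [MeasurableSpace X] [BorelSpace X] (ν : Measure X)
    [ν.IsAddHaarMeasure] (P : ℕ → Test X) (h0 : ∀ j x, 0 ≤ P j x) (h1 : ∀ j, ∫ x, P j x ∂ν = 1)
    (h2 : ∀ j x, P j x ≠ 0 → ‖x‖ ≤ 1 / (j + 1)) {φ : X → ℝ} (hφ : Continuous φ) (x : X) :
    Filter.Tendsto (fun j => ∫ z, P j z * φ (x - z) ∂ν) Filter.atTop (𝓝 (φ x)) := by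
  refine convolution_tendsto_right (μ := ν) (φ := fun j => P j) (g := fun _ => φ) (k := fun _ => x)
    (Filter.Eventually.of_forall h0) (Filter.Eventually.of_forall h1) ?_
    (Filter.Eventually.of_forall fun _ => hφ.aestronglyMeasurable)
    ((hφ.tendsto x).comp Filter.tendsto_snd) tendsto_const_nhds
  rw [Filter.tendsto_smallSets_iff]
  intro s hs
  obtain ⟨ε, hε, hs⟩ := Metric.mem_nhds_iff.1 hs
  obtain ⟨N, hN⟩ := exists_nat_one_div_lt hε
  filter_upwards [Filter.eventually_ge_atTop N] with j hj z hz
  refine hs (mem_ball_zero_iff.2 (lt_of_le_of_lt (h2 j z hz) (lt_of_le_of_lt ?_ hN)))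
  gcongr

theorem tendsto_conv_mollifier (f : Test T) (x : T) :
    Filter.Tendsto (fun j => conv μ (mollifier μ j) f x) Filter.atTop (𝓝 (f x)) :=
  tendsto_integral_mul_of_shrinking μ (mollifier μ) (mollifier_nonneg μ) (integral_mollifier μ)
    (fun _ _ h => (norm_lt_of_mollifier_ne_zero μ h).le) f.continuous x

theorem eventually_conv_mollifier_ne_zero {f : Test T} (hf : f ≠ 0) :
    ∀ᶠ j in Filter.atTop, conv μ (mollifier μ j) f ≠ 0 := by
  obtain ⟨x, hx⟩ : ∃ x, f x ≠ 0 := by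
    by_contra! h
    exact hf (TestFunction.ext h)
  filter_upwards [(tendsto_conv_mollifier μ f x).eventually_ne hx] with j hj h
  exact hj (by rw [h]; rfl)

variable {n : ℕ}

theorem conv_tensor (f g : Fin n → Test T) :
    conv (Measure.pi fun _ => μ) (tensor f) (tensor g) = tensor fun i => conv μ (f i) (g i) := by
  ext x
  rw [conv_apply, tensor_apply]
  simp_rw [conv_apply, tensor_apply, ← Finset.prod_mul_distrib]
  exact integral_fintype_prod_eq_prod (fun i z => f i z * g i (x i - z))

/-- The tensor power of a mollifier. -/
def mollifierTensor (n : ℕ) (j : ℕ) : Test (Fin n → T) := tensor fun _ => mollifier μ j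

theorem mollifierTensor_nonneg (j : ℕ) (x : Fin n → T) : 0 ≤ mollifierTensor μ n j x :=
  (Finset.prod_nonneg fun i _ => mollifier_nonneg μ j (x i) : 0 ≤ ∏ i, mollifier μ j (x i))

theorem integral_mollifierTensor (j : ℕ) :
    ∫ x, mollifierTensor μ n j x ∂(Measure.pi fun _ => μ) = 1 := by
  refine (integral_fintype_prod_eq_prod (fun _ => mollifier μ j)).trans ?_
  simp [integral_mollifier]

theorem norm_le_of_mollifierTensor_ne_zero {j : ℕ} {x : Fin n → T}
    (h : mollifierTensor μ n j x ≠ 0) : ‖x‖ ≤ 1 / (j + 1) := by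
  rw [mollifierTensor, tensor_apply] at h
  exact (pi_norm_le_iff_of_nonneg (by positivity)).2 fun i =>
    (norm_lt_of_mollifier_ne_zero μ (Finset.prod_ne_zero_iff.1 h i (Finset.mem_univ i))).le

theorem tendsto_integral_mollifierTensor_mul {φ : (Fin n → T) → ℝ} (hφ : Continuous φ)
    (x : Fin n → T) :
    Filter.Tendsto (fun j => ∫ z, mollifierTensor μ n j z * φ (x - z) ∂(Measure.pi fun _ => μ))
      Filter.atTop (𝓝 (φ x)) :=
  tendsto_integral_mul_of_shrinking _ (mollifierTensor μ n) (mollifierTensor_nonneg μ)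
    (integral_mollifierTensor μ) (fun _ _ h => norm_le_of_mollifierTensor_ne_zero μ h) hφ x

theorem abs_integral_mollifierTensor_mul_le {φ : (Fin n → T) → ℝ} (x : Fin n → T) {C : ℝ}
    (hC : ∀ z, ‖z‖ ≤ 1 → |φ (x - z)| ≤ C) (j : ℕ) :
    |∫ z, mollifierTensor μ n j z * φ (x - z) ∂(Measure.pi fun _ => μ)| ≤ C := by
  have h1 : ∫ z, mollifierTensor μ n j z * C ∂(Measure.pi fun _ => μ) = C := by
    rw [integral_mul_const, integral_mollifierTensor, one_mul]
  rw [← h1, ← Real.norm_eq_abs]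
  refine norm_integral_le_of_norm_le
    (((mollifierTensor μ n j).continuous.integrable_of_hasCompactSupport
      (mollifierTensor μ n j).hasCompactSupport).mul_const C)
    (Filter.Eventually.of_forall fun z => ?_)
  rw [norm_mul, Real.norm_of_nonneg (mollifierTensor_nonneg μ j z)]
  by_cases hz : mollifierTensor μ n j z = 0
  · simp [hz]
  · refine mul_le_mul_of_nonneg_left (hC z ((norm_le_of_mollifierTensor_ne_zero μ hz).trans ?_))
      (mollifierTensor_nonneg μ j z)
    rw [div_le_one (by positivity)]
    linarith [(Nat.cast_nonneg j : (0 : ℝ) ≤ j)]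

/-- A distribution is determined by its values on elementary tensors. -/
theorem eq_zero_of_tensor_eq_zero (ω : StrongDual ℝ (Test (Fin n → T)))
    (h : ∀ f : Fin n → Test T, ω (tensor f) = 0) : ω = 0 := by
  let μ : Measure T := Measure.addHaar
  let ν : Measure (Fin n → T) := Measure.pi fun _ => μ
  -- The convolution is a superposition of translates of the elementary tensor $\delta_j^{\otimes
  -- n}$, on each of which `ω` vanishes.
  have h1 (θ : Test (Fin n → T)) (j : ℕ) :
      ω (subFrom 0 (conv ν θ (mollifierTensor μ n j))) = 0 := by
    rw [← integral_mul_subFrom]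
    simp [mollifierTensor, subFrom_tensor, h]
  have h2 (θ : Test (Fin n → T)) : ω (subFrom 0 θ) = 0 := by
    refine tendsto_nhds_unique (tendsto_integral_mollifierTensor_mul μ
      (contDiff_subFrom ω θ).continuous 0) ?_
    refine tendsto_const_nhds.congr fun j => ?_
    rw [integral_mul_subFrom, conv_comm]
    exact (h1 θ j).symm
  ext θ
  have : subFrom 0 (subFrom 0 θ) = θ := by ext x; simp
  rw [← this, h2]
  rfl

end Mollifier

/-! ### Polarization of symmetric linear forms on test functions -/

section TensorPolarization

variable {T : Type*} [NormedAddCommGroup T] [NormedSpace ℝ T] {n : ℕ}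

theorem permute_apply (σ : Equiv.Perm (Fin n)) (ψ : Test (Fin n → T)) (x : Fin n → T) :
    permute σ ψ x = ψ (x ∘ σ) := rfl

theorem tensor_comp_perm (f : Fin n → Test T) (σ : Equiv.Perm (Fin n)) :
    tensor (fun i => f (σ i)) = permute σ.symm (tensor f) := by
  ext x
  rw [permute_apply, tensor_apply, tensor_apply]
  exact Fintype.prod_equiv σ _ _ fun i => by simp

theorem tensor_zero (hn : n ≠ 0) : tensor (fun _ : Fin n => (0 : Test T)) = 0 := by
  ext x
  rw [tensor_apply]
  exact Finset.prod_eq_zero (Finset.mem_univ (⟨0, Nat.pos_of_ne_zero hn⟩ : Fin n)) rfl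

theorem sum_apply {ι X : Type*} [NormedAddCommGroup X] [NormedSpace ℝ X] (s : Finset ι)
    (f : ι → Test X) (x : X) : (∑ i ∈ s, f i) x = ∑ i ∈ s, f i x :=
  map_sum ({ toFun := fun f : Test X => f x, map_zero' := rfl, map_add' := fun _ _ => rfl } :
    Test X →+ ℝ) f s

/-- The base point `g` drops out of the alternating sum; it is kept free because Baire's theorem
gives bounds only near an unknown point. -/
theorem sum_tensor_eq (g : Test T) (f : Fin n → Test T) :
    ∑ S : Finset (Fin n), (-1 : ℝ) ^ (n - S.card) • tensor (fun _ : Fin n => g + ∑ i ∈ S, f i) =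
      ∑ σ : Equiv.Perm (Fin n), tensor fun i => f (σ i) := by
  ext x
  rw [sum_apply, sum_apply]
  simp only [tensor_apply]
  rw [← polarization (fun i => g (x i)) fun j i => f j (x i)]
  refine Finset.sum_congr rfl fun S _ => ?_
  change _ * tensor (fun _ : Fin n => g + ∑ i ∈ S, f i) x = _
  rw [tensor_apply]
  congr 2
  ext i
  rw [← sum_apply]
  rfl

/-- A symmetric linear form is recovered on elementary tensors from its values on tensor powers. -/
theorem polarization_linear (l : Test (Fin n → T) →ₗ[ℝ] ℝ)
    (hl : ∀ (σ : Equiv.Perm (Fin n)) ψ, l (permute σ ψ) = l ψ) (g : Test T) (f : Fin n → Test T) :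
    (n.factorial : ℝ)⁻¹ * ∑ S : Finset (Fin n), (-1 : ℝ) ^ (n - S.card) *
      l (tensor fun _ : Fin n => g + ∑ i ∈ S, f i) = l (tensor f) := by
  have h := congrArg l (sum_tensor_eq g f)
  simp only [map_sum, map_smul, smul_eq_mul, tensor_comp_perm, hl, Finset.sum_const,
    Finset.card_univ, Fintype.card_perm, Fintype.card_fin, nsmul_eq_mul] at h
  rw [h, inv_mul_cancel_left₀ (by exact_mod_cast n.factorial_ne_zero)]

theorem subFrom_zero_sum_reflect (S : Finset (Fin n)) (f : Fin n → Test T) :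
    subFrom 0 (∑ i ∈ S, reflect (f i)) = ∑ i ∈ S, f i := by
  ext x
  rw [subFrom_apply, sum_apply, sum_apply]
  refine Finset.sum_congr rfl fun i _ => ?_
  change f i (-(0 - x)) = f i x
  simp

end TensorPolarization

/-! ### Continuous functions as linear forms on test functions -/

section Pairing

theorem tensorConv_apply {T : Type*} [NormedAddCommGroup T] [NormedSpace ℝ T]
    [FiniteDimensional ℝ T] [MeasurableSpace T] [BorelSpace T] (μ : Measure T) {n : ℕ}
    (h : Test T) (φ : (Fin n → T) → ℝ) (x : Fin n → T) :
    tensorConv μ h φ x =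
      ∫ z, tensor (fun _ : Fin n => h) z * φ (x - z) ∂(Measure.pi fun _ => μ) := rfl

variable {T : Type*} [NormedAddCommGroup T] [NormedSpace ℝ T] [FiniteDimensional ℝ T]
  [MeasurableSpace T] [BorelSpace T] (μ : Measure T) [μ.IsAddHaarMeasure] {n : ℕ}

theorem integrable_mul_of_continuous (ψ : Test (Fin n → T)) {φ : (Fin n → T) → ℝ}
    (hφ : Continuous φ) : Integrable (fun z => ψ z * φ z) (Measure.pi fun _ => μ) :=
  (ψ.continuous.mul hφ).integrable_of_hasCompactSupport ψ.hasCompactSupport.mul_right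

/-- The linear form `ψ ↦ ∫ ψ φ` on test functions given by a continuous function `φ`. -/
def pairing (φ : (Fin n → T) → ℝ) (hφ : Continuous φ) : Test (Fin n → T) →ₗ[ℝ] ℝ where
  toFun ψ := ∫ z, ψ z * φ z ∂(Measure.pi fun _ => μ)
  map_add' ψ θ := by
    rw [← integral_add (integrable_mul_of_continuous μ ψ hφ)
      (integrable_mul_of_continuous μ θ hφ)]
    exact integral_congr_ae (Filter.Eventually.of_forall fun z => add_mul _ _ _)
  map_smul' c ψ := by
    rw [RingHom.id_apply, ← integral_smul]
    exact integral_congr_ae (Filter.Eventually.of_forall fun z => mul_assoc _ _ _)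

theorem pairing_apply (φ : (Fin n → T) → ℝ) (hφ : Continuous φ) (ψ : Test (Fin n → T)) :
    pairing μ φ hφ ψ = ∫ z, ψ z * φ z ∂(Measure.pi fun _ => μ) := rfl

theorem pairing_permute {φ : (Fin n → T) → ℝ} (hφ : Continuous φ)
    (hs : ∀ (σ : Equiv.Perm (Fin n)) (x : Fin n → T), φ (x ∘ σ) = φ x) (σ : Equiv.Perm (Fin n))
    (ψ : Test (Fin n → T)) : pairing μ φ hφ (permute σ ψ) = pairing μ φ hφ ψ := by
  have h := (measurePreserving_piCongrLeft (fun _ : Fin n => μ) σ.symm).integral_comp'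
    (fun z => ψ z * φ z)
  rw [pairing_apply, pairing_apply, ← h]
  refine integral_congr_ae (Filter.Eventually.of_forall fun z => ?_)
  have h1 : MeasurableEquiv.piCongrLeft (fun _ : Fin n => T) σ.symm z = z ∘ σ := by
    ext i
    have := Equiv.piCongrLeft_apply_apply (fun _ : Fin n => T) σ.symm z (σ i)
    rw [Equiv.symm_apply_apply] at this
    exact this
  simp only [h1, hs, permute_apply]

theorem tensorConv_eq_pairing (h : Test T) {φ : (Fin n → T) → ℝ} (hφ : Continuous φ)
    (x : Fin n → T) :
    tensorConv μ h φ x = pairing μ φ hφ (tensor fun i => subFrom (x i) h) := by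
  rw [tensorConv_apply, pairing_apply, ← integral_sub_left_eq_self _ _ x]
  simp only [sub_sub_cancel]
  rfl

end Pairing

/-! ### The smooth functions `w(f)` and their limits -/

section WFacts

variable {T : Type*} [NormedAddCommGroup T] [NormedSpace ℝ T] {n : ℕ}

/-- Evaluation of symmetric smooth functions at a point. -/
def evalAt (x : Fin n → T) : SymSmooth T n →ₗ[ℝ] ℝ where
  toFun φ := φ.1 x
  map_add' _ _ := rfl
  map_smul' _ _ := rfl

variable [FiniteDimensional ℝ T] [MeasurableSpace T] [BorelSpace T] {μ : Measure T}
  [μ.IsAddHaarMeasure]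

theorem proj_zero (w : W μ n) : proj 0 w = 0 := by simp [proj]

theorem proj_of_ne {f : Test T} (hf : f ≠ 0) (w : W μ n) : proj f w = w.1 ⟨f, hf⟩ := by
  simp [proj, hf]

theorem continuous_proj (f : Test T) (w : W μ n) : Continuous (proj f w).1 :=
  (proj f w).1.contDiff.continuous

theorem proj_conv (w : W μ n) {h g : Test T} (hg : g ≠ 0) (hc : conv μ h g ≠ 0) :
    ⇑(proj (conv μ h g) w).1 = tensorConv μ h (proj g w).1 := by
  rw [proj_of_ne hc, proj_of_ne hg]
  exact w.2 ⟨_, hc⟩ ⟨g, hg⟩ h rfl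

/-- Both sides are $w(f\star g)$, by commutativity of convolution. -/
theorem tensorConv_proj_comm (w : W μ n) {f g : Test T} (hf : f ≠ 0) (hg : g ≠ 0)
    (hc : conv μ g f ≠ 0) : tensorConv μ f (proj g w).1 = tensorConv μ g (proj f w).1 := by
  rw [← proj_conv w hf hc, ← proj_conv w hg (by rwa [conv_comm]), conv_comm]

theorem eventually_tensorConv_proj_mollifier {f : Test T} (hf : f ≠ 0) :
    ∀ᶠ j in Filter.atTop, ∀ w : W μ n, tensorConv μ f (proj (mollifier μ j) w).1 =
      tensorConv μ (mollifier μ j) (proj f w).1 := by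
  filter_upwards [eventually_conv_mollifier_ne_zero μ hf] with j hj w
  exact tensorConv_proj_comm w hf (mollifier_ne_zero μ j) hj

/-- For large $j$ the roles of $f$ and $\delta_j$ can be exchanged, and
$\otimes^nC_{\delta_j}w(f)\to w(f)$. At $f=0$ the convention $\Pi_0=0$ fits since $0^{\otimes n}=0$
for $n\ne0$. -/
theorem tendsto_tensorConv_proj_mollifier (hn : n ≠ 0) (w : W μ n) (f : Test T) (x : Fin n → T) :
    Filter.Tendsto (fun j => tensorConv μ f (proj (mollifier μ j) w).1 x) Filter.atTop
      (𝓝 ((proj f w).1 x)) := by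
  by_cases hf : f = 0
  · subst hf
    rw [proj_zero]
    refine tendsto_const_nhds.congr fun j => ?_
    rw [tensorConv_apply, tensor_zero hn]
    simp
    rfl
  · refine (tendsto_integral_mollifierTensor_mul μ (continuous_proj f w) x).congr' ?_
    filter_upwards [eventually_tensorConv_proj_mollifier (μ := μ) (n := n) hf] with j hj
    rw [hj w]
    rfl

theorem pairing_proj_permute (f : Test T) (w : W μ n) (σ : Equiv.Perm (Fin n))
    (ψ : Test (Fin n → T)) : pairing μ (proj f w).1 (continuous_proj f w) (permute σ ψ) =
      pairing μ (proj f w).1 (continuous_proj f w) ψ :=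
  pairing_permute μ (continuous_proj f w) (proj f w).2 σ ψ

theorem tilde_eq (w : W μ n) (f : Fin n → Test T) :
    tilde w f = (n.factorial : ℝ)⁻¹ * ∑ S : Finset (Fin n), (-1 : ℝ) ^ (n - S.card) *
      (proj (∑ i ∈ S, reflect (f i)) w).1 0 := by
  change evalAt 0 (polProj (fun i => reflect (f i)) w) = _
  simp only [polProj, map_smul, map_sum, smul_eq_mul]
  rfl

/-- Polarization reduces the pairing to tensor powers of $\sum_{i\in S}f_i$, and pairing with such a
power is convolution by its reflection, evaluated at $0$. -/
theorem tendsto_pairing_tilde (hn : n ≠ 0) (w : W μ n) (f : Fin n → Test T) :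
    Filter.Tendsto (fun j => pairing μ (proj (mollifier μ j) w).1 (continuous_proj _ w) (tensor f))
      Filter.atTop (𝓝 (tilde w f)) := by
  rw [tilde_eq]
  have h := fun j => polarization_linear _ (pairing_proj_permute (mollifier μ j) w) 0 f
  simp_rw [← h]
  refine (tendsto_finsetSum _ fun S _ => Filter.Tendsto.const_mul _ ?_).const_mul _
  refine (tendsto_tensorConv_proj_mollifier hn w (∑ i ∈ S, reflect (f i)) 0).congr fun j => ?_
  rw [tensorConv_eq_pairing μ _ (continuous_proj _ w)]
  simp only [Pi.zero_apply, subFrom_zero_sum_reflect, zero_add]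

/-- Both sides are limits of the same sequence. Since $\widetilde w$ thus recovers $w$, injectivity
follows. -/
theorem proj_apply_eq_tilde (hn : n ≠ 0) (w : W μ n) (f : Test T) (x : Fin n → T) :
    (proj f w).1 x = tilde w fun i => subFrom (x i) f := by
  refine tendsto_nhds_unique (tendsto_tensorConv_proj_mollifier hn w f x) ?_
  refine (tendsto_pairing_tilde hn w fun i => subFrom (x i) f).congr fun j => ?_
  rw [tensorConv_eq_pairing μ _ (continuous_proj _ w)]

theorem eq_zero_of_tilde_eq_zero (hn : n ≠ 0) (w : W μ n) (h : ∀ f, tilde w f = 0) : w = 0 := by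
  refine Subtype.ext (funext fun f => Subtype.ext (Subtype.ext (funext fun x => ?_)))
  have h1 := proj_apply_eq_tilde hn w f.1 x
  rw [h, proj_of_ne f.2] at h1
  exact h1

theorem tilde_add (w₁ w₂ : W μ n) (f : Fin n → Test T) :
    tilde (w₁ + w₂) f = tilde w₁ f + tilde w₂ f := by
  have h (g : Test T) : (proj g (w₁ + w₂)).1 0 = (proj g w₁).1 0 + (proj g w₂).1 0 := by
    by_cases hg : g = 0
    · subst hg
      simp only [proj_zero]
      exact (add_zero (0 : ℝ)).symm
    · simp only [proj_of_ne hg]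
      rfl
  simp only [tilde_eq, h, mul_add, Finset.sum_add_distrib]

theorem tilde_smul (c : ℝ) (w : W μ n) (f : Fin n → Test T) :
    tilde (c • w) f = c * tilde w f := by
  have h (g : Test T) : (proj g (c • w)).1 0 = c * (proj g w).1 0 := by
    by_cases hg : g = 0
    · subst hg
      simp only [proj_zero]
      exact (mul_zero c).symm
    · simp only [proj_of_ne hg]
      rfl
  simp only [tilde_eq, h, Finset.mul_sum]
  exact Finset.sum_congr rfl fun S _ => by ring

/-- The Wilsonian generalized function `f ↦ ⊗ⁿ C_f ω` of a symmetric distribution `ω`. -/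
def ofDist (μ : Measure T) [μ.IsAddHaarMeasure] (ω : SymDist T n) : W μ n where
  val f := ⟨⟨fun x => ω.1 (subFrom x (tensor fun _ => f.1)), contDiff_subFrom ω.1 _⟩,
    fun σ x => by
      change ω.1 (subFrom (x ∘ σ) (tensor fun _ => f.1)) = ω.1 (subFrom x (tensor fun _ => f.1))
      rw [← ω.2 σ (subFrom (x ∘ σ) (tensor fun _ => f.1))]
      congr 1
      ext y
      rw [permute_apply, subFrom_apply, subFrom_apply, tensor_apply, tensor_apply]
      exact Fintype.prod_equiv σ _ _ fun i => rfl⟩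
  property f g h hf := by
    ext x
    change ω.1 (subFrom x (tensor fun _ => f.1)) = ∫ z, tensor (fun _ : Fin n => h) z *
      ω.1 (subFrom (x - z) (tensor fun _ => g.1)) ∂(Measure.pi fun _ => μ)
    rw [integral_mul_subFrom, conv_tensor, hf]

theorem tilde_ofDist (hn : n ≠ 0) (ω : SymDist T n) (f : Fin n → Test T) :
    tilde (ofDist μ ω) f = ω.1 (tensor f) := by
  have h (g : Test T) :
      (proj g (ofDist μ ω)).1 0 = ω.1 (tensor fun _ : Fin n => subFrom 0 g) := by
    by_cases hg : g = 0
    · subst hg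
      rw [proj_zero, show subFrom (0 : T) 0 = 0 from rfl, tensor_zero hn, map_zero]
      rfl
    · rw [proj_of_ne hg]
      rfl
  rw [tilde_eq]
  simp_rw [h, subFrom_zero_sum_reflect]
  have := polarization_linear ω.1.toLinearMap ω.2 0 f
  simp only [zero_add] at this
  exact this

end WFacts

/-! ### Uniform boundedness -/

section UniformBound

variable {T : Type*} [NormedAddCommGroup T] [NormedSpace ℝ T] {n : ℕ}

theorem tensor_smul (c : Fin n → ℝ) (f : Fin n → Test T) :
    tensor (fun i => c i • f i) = (∏ i, c i) • tensor f := by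
  ext x
  change tensor (fun i => c i • f i) x = (∏ i, c i) * tensor f x
  rw [tensor_apply, tensor_apply, ← Finset.prod_mul_distrib]
  rfl

variable [FiniteDimensional ℝ T] [MeasurableSpace T] [BorelSpace T] (μ : Measure T)
  [μ.IsAddHaarMeasure]

/-- Dominated convergence: near a given $f_0$ the sup norm is below that of $f_0$ plus one. It gives
the closed sets for Baire's theorem. -/
theorem continuous_integral_prod_mul (K : Compacts T) {φ : (Fin n → T) → ℝ} (hφ : Continuous φ) :
    Continuous fun f : 𝓓_{K}(T, ℝ) =>
      ∫ z, (∏ i, f (z i)) * φ z ∂(Measure.pi fun _ : Fin n => μ) := by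
  have hK : IsCompact (Set.univ.pi fun _ : Fin n => (K : Set T)) :=
    isCompact_univ_pi fun _ => K.isCompact
  let c (f : 𝓓_{K}(T, ℝ)) : ℝ := ‖ContDiffMapSupportedIn.toBoundedContinuousFunctionCLM ℝ f‖
  have hc : Continuous c :=
    (ContDiffMapSupportedIn.toBoundedContinuousFunctionCLM ℝ).continuous.norm
  have hfc (f : 𝓓_{K}(T, ℝ)) (x : T) : ‖f x‖ ≤ c f :=
    (ContDiffMapSupportedIn.toBoundedContinuousFunctionCLM ℝ f).norm_coe_le_norm x
  have hfK (f : 𝓓_{K}(T, ℝ)) {z : Fin n → T} (hz : z ∉ Set.univ.pi fun _ : Fin n => (K : Set T)) :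
      ∏ i, f (z i) = 0 := by
    obtain ⟨i, hi⟩ : ∃ i, z i ∉ K := by simpa [Set.mem_pi] using hz
    exact Finset.prod_eq_zero (Finset.mem_univ i) (f.zero_on_compl hi)
  refine continuous_iff_continuousAt.2 fun f₀ => continuousAt_of_dominated
    (bound := (Set.univ.pi fun _ : Fin n => (K : Set T)).indicator
      fun z => (c f₀ + 1) ^ n * |φ z|) ?_ ?_ ?_ ?_
  · refine Filter.Eventually.of_forall fun f => Continuous.aestronglyMeasurable ?_
    have := f.contDiff.continuous
    fun_prop
  · filter_upwards [hc.continuousAt.eventually_lt continuousAt_const (lt_add_one (c f₀))] with f hf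
    refine Filter.Eventually.of_forall fun z => ?_
    by_cases hz : z ∈ Set.univ.pi fun _ : Fin n => (K : Set T)
    · rw [Set.indicator_of_mem hz, norm_mul, norm_prod]
      refine mul_le_mul_of_nonneg_right ?_ (abs_nonneg _)
      refine (Finset.prod_le_prod (fun i _ => norm_nonneg _)
        fun i _ => (hfc f (z i)).trans hf.le).trans ?_
      simp
    · rw [Set.indicator_of_notMem hz, hfK f hz, zero_mul, norm_zero]
  · exact (integrable_indicator_iff hK.measurableSet).2
      ((by fun_prop : Continuous fun z =>
        (c f₀ + 1) ^ n * |φ z|).continuousOn.integrableOn_compact hK)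
  · refine Filter.Eventually.of_forall fun z => Continuous.continuousAt ?_
    fun_prop

/-- Pointwise bounded polynomials `f ↦ ∫ f^{⊗n} φ` on `𝒟_K` are equicontinuous. -/
theorem exists_pairing_tensor_le {ι : Type*} (φ : ι → (Fin n → T) → ℝ)
    (hφ : ∀ a, Continuous (φ a))
    (hs : ∀ a, ∀ (σ : Equiv.Perm (Fin n)) (x : Fin n → T), φ a (x ∘ σ) = φ a x)
    (hb : ∀ f : Test T, ∃ C, ∀ a, |pairing μ (φ a) (hφ a) (tensor fun _ => f)| ≤ C)
    {K : Set T} (hK : IsCompact K) :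
    ∃ (m : ℕ) (C : ℝ), 0 ≤ C ∧ ∀ a, ∀ f : Fin n → Test T, (∀ i, tsupport (f i) ⊆ K) →
      |pairing μ (φ a) (hφ a) (tensor f)| ≤ C * ∏ i, (1 + cNorm m (f i)) := by
  let K' : Compacts T := ⟨K, hK⟩
  let J (f : 𝓓_{K'}(T, ℝ)) : Test T := TestFunction.ofSupportedIn (Ω := ⊤) (fun _ _ => trivial) f
  let A (N : ℕ) : Set 𝓓_{K'}(T, ℝ) :=
    {f | ∀ a, |pairing μ (φ a) (hφ a) (tensor fun _ => J f)| ≤ N}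
  have hA (N : ℕ) : IsClosed (A N) := by
    simp only [A, Set.ofPred_forall]
    exact isClosed_iInter fun a =>
      isClosed_le (continuous_integral_prod_mul μ K' (hφ a)).abs continuous_const
  have hU : ⋃ N, A N = Set.univ := by
    refine Set.eq_univ_of_forall fun f => ?_
    obtain ⟨C, hC⟩ := hb (J f)
    obtain ⟨N, hN⟩ := exists_nat_ge C
    exact Set.mem_iUnion.2 ⟨N, fun a => (hC a).trans hN⟩
  -- By Baire's theorem all the polynomials are bounded by `N` on one neighbourhood of some `g`,
  -- which contains a $C^m$ ball of radius `ε`.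
  obtain ⟨N, g, hg⟩ := nonempty_interior_of_iUnion_of_closed hA hU
  obtain ⟨s, ε, hε, hball⟩ := ((ContDiffMapSupportedIn.withSeminorms ℝ T ℝ ⊤ K').mem_nhds_iff g _).1
    (mem_interior_iff_mem_nhds.1 hg)
  let m := s.sup id
  have hgood (f : Test T) (hf : tsupport f ⊆ K) (hfε : cNorm m f < ε) (a : ι) :
      |pairing μ (φ a) (hφ a) (tensor fun _ => J g + f)| ≤ N := by
    have h : g + toSupportedIn K' f hf ∈ A N := by
      refine hball ?_
      rw [Seminorm.mem_ball, add_sub_cancel_left]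
      exact (sup_seminorm_le_cNorm K' (toSupportedIn K' f hf)
        fun i hi => Finset.le_sup (f := id) hi).trans_lt hfε
    exact h a
  refine ⟨m, 2 ^ n * N * ((n + 1) / ε) ^ n, by positivity, fun a f hf => ?_⟩
  -- Each rescaled $c_if_i$ has norm at most $\varepsilon/(n+1)$, so any partial sum, of at most $n$
  -- terms, stays inside the ball. The summand $1$ avoids division by zero.
  let c (i : Fin n) : ℝ := ε / ((n + 1) * (1 + cNorm m (f i)))
  have hpos (i : Fin n) : 0 < 1 + cNorm m (f i) := by linarith [cNorm_nonneg m (f i)]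
  have hc (i : Fin n) : 0 < c i := by have := hpos i; positivity
  have hcf (i : Fin n) : cNorm m (c i • f i) ≤ ε / (n + 1) := by
    refine (cNorm_smul_le _ _ _).trans ?_
    rw [abs_of_pos (hc i)]
    have := hpos i
    rw [div_mul_eq_mul_div, div_le_div_iff₀ (by positivity) (by positivity)]
    have h1 : 0 < (n : ℝ) + 1 := by positivity
    nlinarith [mul_pos hε h1]
  have hS (S : Finset (Fin n)) :
      |pairing μ (φ a) (hφ a) (tensor fun _ => J g + ∑ i ∈ S, c i • f i)| ≤ N := by
    refine hgood _ ?_ ?_ a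
    · refine closure_minimal (fun x hx => ?_) hK.isClosed
      by_contra hxK
      refine hx ?_
      rw [sum_apply]
      refine Finset.sum_eq_zero fun i _ => ?_
      have h0 : f i x = 0 := image_eq_zero_of_notMem_tsupport fun h => hxK (hf i h)
      change c i * f i x = 0
      rw [h0, mul_zero]
    · refine (cNorm_sum_le _ _ _).trans_lt ?_
      refine (Finset.sum_le_card_nsmul _ _ _ fun i _ => hcf i).trans_lt ?_
      have h1 : (S.card : ℝ) ≤ n := by
        exact_mod_cast (Finset.card_le_univ S).trans (by simp)
      rw [nsmul_eq_mul, mul_div_assoc', div_lt_iff₀ (by positivity)]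
      nlinarith
  have hpol := polarization_linear _ (pairing_permute μ (hφ a) (hs a)) (J g) fun i => c i • f i
  rw [tensor_smul, map_smul, smul_eq_mul] at hpol
  have hsum : |∑ S : Finset (Fin n), (-1 : ℝ) ^ (n - S.card) *
      pairing μ (φ a) (hφ a) (tensor fun _ => J g + ∑ i ∈ S, c i • f i)| ≤ 2 ^ n * N := by
    refine (Finset.abs_sum_le_sum_abs _ _).trans ?_
    refine (Finset.sum_le_card_nsmul _ _ (N : ℝ) fun S _ => ?_).trans (by simp)
    rw [abs_mul, abs_pow, abs_neg, abs_one, one_pow, one_mul]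
    exact hS S
  have hprod : (∏ i, c i) * (((n + 1) / ε) ^ n * ∏ i, (1 + cNorm m (f i))) = 1 := by
    rw [show ((n + 1) / ε : ℝ) ^ n = ∏ _i : Fin n, ((n + 1) / ε : ℝ) by
        rw [Finset.prod_const, Finset.card_univ, Fintype.card_fin],
      ← Finset.prod_mul_distrib, ← Finset.prod_mul_distrib]
    refine Finset.prod_eq_one fun i _ => ?_
    have := hpos i
    simp only [c]
    field_simp
  have hP : 0 ≤ ((n + 1) / ε) ^ n * ∏ i, (1 + cNorm m (f i)) :=
    mul_nonneg (by positivity) (Finset.prod_nonneg fun i _ => (hpos i).le)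
  have hfin : |(∏ i, c i) * pairing μ (φ a) (hφ a) (tensor f)| ≤ 2 ^ n * N := by
    rw [← hpol, abs_mul]
    refine (mul_le_of_le_one_left (abs_nonneg _) ?_).trans hsum
    rw [abs_of_nonneg (by positivity)]
    exact inv_le_one_of_one_le₀ (by exact_mod_cast n.factorial_pos)
  calc |pairing μ (φ a) (hφ a) (tensor f)|
      = |(∏ i, c i) * pairing μ (φ a) (hφ a) (tensor f)| *
          (((n + 1) / ε) ^ n * ∏ i, (1 + cNorm m (f i))) := by
        rw [abs_mul, abs_of_nonneg (Finset.prod_nonneg fun i _ => (hc i).le), mul_right_comm,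
          hprod, one_mul]
    _ ≤ 2 ^ n * N * (((n + 1) / ε) ^ n * ∏ i, (1 + cNorm m (f i))) :=
        mul_le_mul_of_nonneg_right hfin hP
    _ = _ := by ring

variable {μ}

/-- Boundedness of a family in `W`, for locally uniform convergence of the functions `w(f)`. -/
def LocallyBounded {ι : Type*} (w : ι → W μ n) : Prop :=
  ∀ (f : Test T) (R : ℝ), ∃ C, ∀ a, ∀ x, ‖x‖ ≤ R → |(proj f (w a)).1 x| ≤ C

/-- For large $j$ the pairing is an average of $w(f^t)$ over the unit ball, bounded uniformly in the
family; the finitely many other $j$ are covered by bounds for $w(\delta_j)$ on the support of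
$f^{\otimes n}$. -/
theorem LocallyBounded.exists_pairing_tensor_self_le (hn : n ≠ 0) {ι : Type*} {w : ι → W μ n}
    (hw : LocallyBounded w) (f : Test T) : ∃ C, ∀ p : ι × ℕ,
      |pairing μ (proj (mollifier μ p.2) (w p.1)).1 (continuous_proj _ _)
        (tensor fun _ => f)| ≤ C := by
  by_cases hf : f = 0
  · exact ⟨0, fun p => by rw [hf, tensor_zero hn, map_zero, abs_zero]⟩
  have hf' : reflect f ≠ 0 := fun h => hf <| by
    ext x
    have : reflect f (-x) = 0 := by rw [h]; rfl
    rw [← neg_neg x]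
    exact this
  have hsub : subFrom 0 (reflect f) = f := by
    ext x
    change f (-(0 - x)) = f x
    simp
  -- The threshold only ensures $\delta_j\star f^t\ne0$, so it does not depend on the member of the
  -- family.
  obtain ⟨j₀, hj₀⟩ := Filter.eventually_atTop.1
    (eventually_tensorConv_proj_mollifier (μ := μ) (n := n) hf')
  obtain ⟨R, hR⟩ :=
    (tensor fun _ : Fin n => f).hasCompactSupport.isCompact.isBounded.subset_closedBall 0
  choose D hD using fun j => hw (mollifier μ j) R
  obtain ⟨C, hC⟩ := hw (reflect f) 1
  let I := ∫ z, |tensor (fun _ : Fin n => f) z| ∂(Measure.pi fun _ : Fin n => μ)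
  refine ⟨|C| + ∑ j ∈ Finset.range j₀, |I * D j|, fun p => ?_⟩
  have hsum : 0 ≤ ∑ j ∈ Finset.range j₀, |I * D j| := Finset.sum_nonneg fun _ _ => abs_nonneg _
  by_cases hp : p.2 < j₀
  · refine le_trans ?_ (le_add_of_nonneg_left (abs_nonneg C))
    refine le_trans ?_ (Finset.single_le_sum (f := fun j => |I * D j|) (fun _ _ => abs_nonneg _)
      (Finset.mem_range.2 hp))
    refine le_trans ?_ (le_abs_self _)
    rw [pairing_apply, ← Real.norm_eq_abs, ← integral_mul_const]
    refine norm_integral_le_of_norm_le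
      ((((tensor fun _ : Fin n => f).continuous.integrable_of_hasCompactSupport
      (tensor fun _ : Fin n => f).hasCompactSupport).abs).mul_const _)
      (Filter.Eventually.of_forall fun z => ?_)
    rw [norm_mul]
    by_cases hz : z ∈ tsupport (tensor fun _ : Fin n => f)
    · exact mul_le_mul_of_nonneg_left (hD p.2 p.1 z (by simpa using hR hz)) (abs_nonneg _)
    · rw [image_eq_zero_of_notMem_tsupport hz]; simp
  · refine le_trans ?_ (le_add_of_nonneg_right hsum)
    have h1 := congrFun (hj₀ p.2 (not_lt.1 hp) (w p.1)) 0
    rw [tensorConv_eq_pairing μ _ (continuous_proj _ _)] at h1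
    simp only [Pi.zero_apply, hsub] at h1
    rw [h1]
    refine le_trans ?_ (le_abs_self C)
    exact abs_integral_mollifierTensor_mul_le μ 0 (fun z hz => hC _ _ (by simpa using hz)) p.2

theorem LocallyBounded.exists_pairing_tensor_le (hn : n ≠ 0) {ι : Type*} {w : ι → W μ n}
    (hw : LocallyBounded w) {K : Set T} (hK : IsCompact K) :
    ∃ (m : ℕ) (C : ℝ), 0 ≤ C ∧ ∀ a j, ∀ f : Fin n → Test T, (∀ i, tsupport (f i) ⊆ K) →
      |pairing μ (proj (mollifier μ j) (w a)).1 (continuous_proj _ _) (tensor f)| ≤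
        C * ∏ i, (1 + cNorm m (f i)) := by
  obtain ⟨m, C, hC, h⟩ := Wilson.exists_pairing_tensor_le μ
    (fun p : ι × ℕ => (proj (mollifier μ p.2) (w p.1)).1) (fun p => continuous_proj _ _)
    (fun p => (proj (mollifier μ p.2) (w p.1)).2) (hw.exists_pairing_tensor_self_le hn) hK
  exact ⟨m, C, hC, fun a j => h (a, j)⟩

end UniformBound

/-! ### Localized plane waves -/

section Wave

variable {T : Type*} [NormedAddCommGroup T] [NormedSpace ℝ T]
  {E : Type*} [NormedAddCommGroup E] [InnerProductSpace ℝ E] (e : T ≃L[ℝ] E)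

/-- The real (`s = 0`) and imaginary (`s = 1`) part of a plane wave, cut off by `χ`. -/
def wave (χ : Test T) (η : E) (s : Fin 2) : Test T where
  toFun x := χ x * Real.cos (2 * Real.pi * inner ℝ η (e x) - (s : ℕ) * (Real.pi / 2))
  contDiff' := χ.contDiff.mul (Real.contDiff_cos.comp
    ((contDiff_const.mul (contDiff_const.inner ℝ e.contDiff)).sub contDiff_const))
  hasCompactSupport' := χ.hasCompactSupport.mul_right
  tsupport_subset' := fun _ _ => trivial

theorem wave_apply (χ : Test T) (η : E) (s : Fin 2) (x : T) : wave e χ η s x =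
    χ x * Real.cos (2 * Real.pi * inner ℝ η (e x) - (s : ℕ) * (Real.pi / 2)) := rfl

theorem tsupport_wave_subset (χ : Test T) (η : E) (s : Fin 2) :
    tsupport (wave e χ η s) ⊆ tsupport χ :=
  tsupport_mul_subset_left

theorem exp_mul_I_eq_sum (θ : ℝ) : Complex.exp (θ * Complex.I) =
    ∑ s : Fin 2, Complex.I ^ (s : ℕ) * (Real.cos (θ - (s : ℕ) * (Real.pi / 2)) : ℝ) := by
  rw [Fin.sum_univ_two]
  simp [Real.cos_sub_pi_div_two, Complex.exp_mul_I, mul_comm Complex.I]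

/-- Leibniz' rule: each derivative of the cosine costs a factor of order $\|\eta\|$. -/
theorem cNorm_wave_le (χ : Test T) (m : ℕ) :
    ∃ C, 0 ≤ C ∧ ∀ (η : E) (s : Fin 2), cNorm m (wave e χ η s) ≤ C * (1 + ‖η‖) ^ m := by
  let c : ℝ := 1 + 2 * Real.pi * ‖(e : T →L[ℝ] E)‖
  have hc : 1 ≤ c := by simp only [c, le_add_iff_nonneg_right]; positivity
  refine ⟨(m + 1) * (2 ^ m * cNorm m χ * c ^ m), by have := cNorm_nonneg m χ; positivity,
    fun η s => ?_⟩
  rw [mul_assoc]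
  refine cNorm_le fun i hi x => ?_
  let L : T →L[ℝ] ℝ := (2 * Real.pi) • (innerSL ℝ η).comp (e : T →L[ℝ] E)
  have hL : ‖L‖ ≤ c * (1 + ‖η‖) := by
    have h1 : ‖L‖ ≤ 2 * Real.pi * (‖η‖ * ‖(e : T →L[ℝ] E)‖) := by
      rw [norm_smul, Real.norm_of_nonneg Real.two_pi_pos.le]
      gcongr
      exact (ContinuousLinearMap.opNorm_comp_le _ _).trans (by rw [innerSL_apply_norm])
    refine h1.trans ?_
    simp only [c]
    have h2 : 0 ≤ 2 * Real.pi * ‖(e : T →L[ℝ] E)‖ := by positivity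
    nlinarith [norm_nonneg η]
  have hb (y : T) (j : ℕ) (hj : j ≤ m) : ‖iteratedFDeriv ℝ j
      (fun x => Real.cos (2 * Real.pi * inner ℝ η (e x) - (s : ℕ) * (Real.pi / 2))) y‖ ≤
        (c * (1 + ‖η‖)) ^ m := by
    have h1 := norm_iteratedFDeriv_comp_right_le L (i := j)
      (f := fun t => Real.cos (t - (s : ℕ) * (Real.pi / 2)))
      (Real.contDiff_cos.comp (contDiff_id.sub contDiff_const)) y
    have h2 : ‖iteratedFDeriv ℝ j (fun t => Real.cos (t - (s : ℕ) * (Real.pi / 2))) (L y)‖ ≤ 1 := by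
      rw [iteratedFDeriv_comp_sub, norm_iteratedFDeriv_eq_norm_iteratedDeriv]
      exact Real.abs_iteratedDeriv_cos_le_one j _
    refine (h1.trans (mul_le_of_le_one_left (by positivity) h2)).trans ?_
    refine (pow_le_pow_left₀ (norm_nonneg _) hL j).trans (pow_le_pow_right₀ ?_ hj)
    nlinarith [norm_nonneg η]
  refine (norm_iteratedFDeriv_mul_le (N := i) (χ.contDiff.of_le (by exact_mod_cast le_top))
    (Real.contDiff_cos.comp ((contDiff_const.mul (contDiff_const.inner ℝ e.contDiff)).sub
      contDiff_const)) x le_rfl).trans ?_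
  have h3 : ∀ k ∈ Finset.range (i + 1), (i.choose k : ℝ) * ‖iteratedFDeriv ℝ k χ x‖ *
      ‖iteratedFDeriv ℝ (i - k) (fun x => Real.cos (2 * Real.pi * inner ℝ η (e x) -
        (s : ℕ) * (Real.pi / 2))) x‖ ≤ i.choose k * (cNorm m χ * (c * (1 + ‖η‖)) ^ m) := by
    intro k hk
    rw [mul_assoc]
    have hk' : k ≤ i := Nat.lt_succ_iff.1 (Finset.mem_range.1 hk)
    refine mul_le_mul_of_nonneg_left (mul_le_mul (norm_iteratedFDeriv_le_cNorm (hk'.trans hi) χ x)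
      (hb x _ ((Nat.sub_le _ _).trans hi)) (norm_nonneg _) (cNorm_nonneg _ _)) (by positivity)
  refine (Finset.sum_le_sum h3).trans ?_
  rw [← Finset.sum_mul, mul_pow]
  have h4 : (∑ k ∈ Finset.range (i + 1), (i.choose k : ℝ)) ≤ 2 ^ m := by
    rw [← Nat.cast_sum, Nat.sum_range_choose]
    push_cast
    exact pow_le_pow_right₀ (by norm_num) hi
  have h5 : 0 ≤ cNorm m χ * (c ^ m * (1 + ‖η‖) ^ m) := by have := cNorm_nonneg m χ; positivity
  calc _ ≤ 2 ^ m * (cNorm m χ * (c ^ m * (1 + ‖η‖) ^ m)) := mul_le_mul_of_nonneg_right h4 h5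
    _ = _ := by ring

variable {n : ℕ}

/-- The linear isomorphism `e × ⋯ × e`, onto the Hilbert sum. -/
def piEquiv (n : ℕ) : (Fin n → T) ≃L[ℝ] PiLp 2 (fun _ : Fin n => E) :=
  (ContinuousLinearEquiv.piCongrRight fun _ => e).trans (PiLp.continuousLinearEquiv 2 ℝ _).symm

theorem inner_piEquiv (ξ : PiLp 2 fun _ : Fin n => E) (x : Fin n → T) :
    inner ℝ ξ (piEquiv e n x) = ∑ i, inner ℝ (ξ i) (e (x i)) :=
  PiLp.inner_apply _ _

/-- The value of the complex multilinear extension of `F` at the plane waves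
`x ↦ χ(x) e^{2πi⟨ξᵢ, x⟩}`, `i = 1, …, n`. -/
def symbol (χ : Test T) (F : (Fin n → Test T) → ℝ) (ξ : PiLp 2 fun _ : Fin n => E) : ℂ :=
  ∑ s : Fin n → Fin 2, (∏ i, Complex.I ^ (s i : ℕ)) * (F fun i => wave e χ (ξ i) (s i) : ℝ)

theorem tensor_mul_exp (χ : Test T) (ξ : PiLp 2 fun _ : Fin n => E) (x : Fin n → T) :
    (tensor (fun _ : Fin n => χ) x : ℂ) *
        Complex.exp (↑(2 * Real.pi * inner ℝ ξ (piEquiv e n x)) * Complex.I) =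
      ∑ s : Fin n → Fin 2, (∏ i, Complex.I ^ (s i : ℕ)) *
        (tensor (fun i => wave e χ (ξ i) (s i)) x : ℝ) := by
  rw [inner_piEquiv, Finset.mul_sum, Complex.ofReal_sum, Finset.sum_mul, Complex.exp_sum]
  simp_rw [exp_mul_I_eq_sum, tensor_apply, Complex.ofReal_prod]
  rw [← Finset.prod_mul_distrib]
  simp_rw [Finset.mul_sum]
  rw [Finset.prod_univ_sum, Fintype.piFinset_univ]
  refine Finset.sum_congr rfl fun s _ => ?_
  rw [← Finset.prod_mul_distrib]
  refine Finset.prod_congr rfl fun i _ => ?_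
  rw [wave_apply]
  push_cast
  ring

theorem norm_symbol_le (χ : Test T) (F : (Fin n → Test T) → ℝ) {C : ℝ}
    (ξ : PiLp 2 fun _ : Fin n => E)
    (h : ∀ s : Fin n → Fin 2, |F fun i => wave e χ (ξ i) (s i)| ≤ C) :
    ‖symbol e χ F ξ‖ ≤ 2 ^ n * C := by
  refine (norm_sum_le _ _).trans ((Finset.sum_le_card_nsmul _ _ C fun s _ => ?_).trans (by simp))
  rw [norm_mul, norm_prod]
  simpa using h s

theorem tendsto_symbol {α : Type*} {l : Filter α} (χ : Test T) {F : α → (Fin n → Test T) → ℝ}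
    {G : (Fin n → Test T) → ℝ} (h : ∀ f, Filter.Tendsto (fun a => F a f) l (𝓝 (G f)))
    (ξ : PiLp 2 fun _ : Fin n => E) :
    Filter.Tendsto (fun a => symbol e χ (F a) ξ) l (𝓝 (symbol e χ G ξ)) :=
  tendsto_finsetSum _ fun _ _ =>
    ((Complex.continuous_ofReal.tendsto _).comp (h _)).const_mul _

theorem tensor_eq_one {R : ℝ} {χ : Test T} (hχ : ∀ x, ‖x‖ ≤ R → χ x = 1) {ψ : Test (Fin n → T)}
    (hψ : tsupport ψ ⊆ Metric.closedBall 0 R) (x : Fin n → T) (hx : ψ x ≠ 0) :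
    tensor (fun _ : Fin n => χ) x = 1 := by
  rw [tensor_apply]
  refine Finset.prod_eq_one fun i _ => hχ _ ((norm_le_pi_norm x i).trans ?_)
  simpa using hψ (subset_closure hx)

variable [FiniteDimensional ℝ T] [MeasurableSpace T] [BorelSpace T] (μ : Measure T)
  [μ.IsAddHaarMeasure]

/-- The real waves recombine into one exponential, so the symbol is the Fourier integral of
$\chi^{\otimes n}\varphi$. Measurability in $\xi$ and Parseval's formula both come from here. -/
theorem symbol_pairing (χ : Test T) {φ : (Fin n → T) → ℝ} (hφ : Continuous φ)
    (ξ : PiLp 2 fun _ : Fin n => E) :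
    symbol e χ (fun f => pairing μ φ hφ (tensor f)) ξ =
      ∫ x, Complex.exp (↑(2 * Real.pi * inner ℝ ξ (piEquiv e n x)) * Complex.I) *
        ((tensor (fun _ : Fin n => χ) x * φ x : ℝ) : ℂ) ∂(Measure.pi fun _ => μ) := by
  have h (x : Fin n → T) :
      Complex.exp (↑(2 * Real.pi * inner ℝ ξ (piEquiv e n x)) * Complex.I) *
        ((tensor (fun _ : Fin n => χ) x * φ x : ℝ) : ℂ) =
      ∑ s : Fin n → Fin 2, (∏ i, Complex.I ^ (s i : ℕ)) *
        ((tensor (fun i => wave e χ (ξ i) (s i)) x * φ x : ℝ) : ℂ) := by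
    rw [Complex.ofReal_mul (tensor (fun _ : Fin n => χ) x), ← mul_assoc, mul_comm (Complex.exp _),
      tensor_mul_exp, Finset.sum_mul]
    exact Finset.sum_congr rfl fun s _ => by push_cast; ring
  simp_rw [h]
  rw [integral_finsetSum _ fun s _ =>
    (integrable_mul_of_continuous μ _ hφ).ofReal.const_mul _]
  refine Finset.sum_congr rfl fun s _ => ?_
  rw [integral_const_mul, integral_complex_ofReal]
  rfl

variable [FiniteDimensional ℝ E] [MeasurableSpace E] [BorelSpace E]

theorem stronglyMeasurable_symbol_pairing (χ : Test T) {φ : (Fin n → T) → ℝ} (hφ : Continuous φ) :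
    StronglyMeasurable (symbol e χ fun f => pairing μ φ hφ (tensor f)) := by
  have : symbol e χ (fun f => pairing μ φ hφ (tensor f)) = fun ξ =>
      ∫ x, Complex.exp (↑(2 * Real.pi * inner ℝ ξ (piEquiv e n x)) * Complex.I) *
        ((tensor (fun _ : Fin n => χ) x * φ x : ℝ) : ℂ) ∂(Measure.pi fun _ => μ) :=
    funext fun ξ => symbol_pairing e μ χ hφ ξ
  rw [this]
  refine StronglyMeasurable.integral_prod_right (Continuous.stronglyMeasurable ?_)
  have h1 := (tensor (fun _ : Fin n => χ)).continuous
  have h2 := (piEquiv e n).continuous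
  simp only [Function.uncurry_def]
  fun_prop

/-- Parseval's formula for the pairing with a continuous function. -/
theorem pairing_eq_integral_hat (χ : Test T) {φ : (Fin n → T) → ℝ} (hφ : Continuous φ)
    (ψ : Test (Fin n → T)) (hχ : ∀ x, ψ x ≠ 0 → tensor (fun _ : Fin n => χ) x = 1) :
    (pairing μ φ hφ ψ : ℂ) = ∫ ξ, hat (piEquiv e n) ψ ξ *
      symbol e χ (fun f => pairing μ φ hφ (tensor f)) ξ := by
  have h1 (x : Fin n → T) : ((ψ x * φ x : ℝ) : ℂ) =
      ∫ ξ, Complex.exp (↑(2 * Real.pi * inner ℝ ξ (piEquiv e n x)) * Complex.I) *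
        (hat (piEquiv e n) ψ ξ * ((tensor (fun _ : Fin n => χ) x * φ x : ℝ) : ℂ)) := by
    simp_rw [← mul_assoc]
    rw [integral_mul_const]
    have h2 := fourierInv_hat (piEquiv e n) ψ x
    simp only [smul_eq_mul] at h2
    rw [← h2]
    by_cases hx : ψ x = 0
    · simp [hx]
    · rw [hχ x hx, one_mul, Complex.ofReal_mul]
  rw [pairing_apply, ← integral_complex_ofReal]
  simp_rw [h1, symbol_pairing, ← integral_const_mul]
  rw [integral_integral_swap]
  · simp_rw [mul_left_comm]
  · have h2 : Integrable (fun z : (Fin n → T) × PiLp 2 fun _ : Fin n => E =>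
        ((tensor (fun _ : Fin n => χ) z.1 * φ z.1 : ℝ) : ℂ) * hat (piEquiv e n) ψ z.2)
        ((Measure.pi fun _ => μ).prod volume) :=
      (integrable_mul_of_continuous μ _ hφ).ofReal.mul_prod (hat (piEquiv e n) ψ).integrable
    have h3 := (piEquiv e n).continuous
    refine (h2.bdd_mul (c := 1) (f := fun z => Complex.exp
      (↑(2 * Real.pi * inner ℝ z.2 (piEquiv e n z.1)) * Complex.I)) ?_ ?_).congr ?_
    · exact Continuous.aestronglyMeasurable (by fun_prop)
    · exact Filter.Eventually.of_forall fun z => (Complex.norm_exp_ofReal_mul_I _).le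
    · exact Filter.Eventually.of_forall fun z => by
        simp only [Function.uncurry]
        ring

end Wave

/-! ### The symbols of a bounded family -/

section SymbolBound

variable {T : Type*} [NormedAddCommGroup T] [NormedSpace ℝ T] [FiniteDimensional ℝ T]
  [MeasurableSpace T] [BorelSpace T] {μ : Measure T} [μ.IsAddHaarMeasure] {n : ℕ}
  {E : Type*} [NormedAddCommGroup E] [InnerProductSpace ℝ E] (e : T ≃L[ℝ] E)

/-- The linear forms approximating the distribution of `w`. -/
def approx (j : ℕ) (w : W μ n) : Test (Fin n → T) →ₗ[ℝ] ℝ :=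
  pairing μ (proj (mollifier μ j) w).1 (continuous_proj _ w)

/-- All waves are supported in the support of `χ`, so the Baire bound applies; each of the $n$
factors contributes growth of order $m$. -/
theorem LocallyBounded.exists_norm_symbol_le (hn : n ≠ 0) {ι : Type*} {w : ι → W μ n}
    (hw : LocallyBounded w) (χ : Test T) : ∃ (M : ℕ) (C : ℝ), 0 ≤ C ∧
      ∀ a j ξ, ‖symbol e χ (fun f => approx j (w a) (tensor f)) ξ‖ ≤ C * (1 + ‖ξ‖) ^ M := by
  obtain ⟨m, C, hC, h⟩ := hw.exists_pairing_tensor_le hn χ.hasCompactSupport.isCompact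
  obtain ⟨D, hD, hwave⟩ := cNorm_wave_le e χ m
  refine ⟨m * n, 2 ^ n * (C * (1 + D) ^ n), by positivity, fun a j ξ => ?_⟩
  refine (norm_symbol_le e χ _ ξ fun s => (h a j _ fun i =>
    tsupport_wave_subset e χ (ξ i) (s i)).trans (mul_le_mul_of_nonneg_left
      (Finset.prod_le_prod (g := fun _ => (1 + D) * (1 + ‖ξ‖) ^ m)
        (fun i _ => add_nonneg zero_le_one (cNorm_nonneg _ _)) fun i _ => ?_) hC)).trans ?_
  · have h1 : ‖ξ i‖ ≤ ‖ξ‖ := PiLp.norm_apply_le ξ i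
    have h2 : (1 + ‖ξ i‖) ^ m ≤ (1 + ‖ξ‖) ^ m := by gcongr
    have h3 : 1 ≤ (1 + ‖ξ‖) ^ m := one_le_pow₀ (by linarith [norm_nonneg ξ])
    have h4 := hwave (ξ i) (s i)
    nlinarith
  · rw [Finset.prod_const, Finset.card_univ, Fintype.card_fin, mul_pow, ← pow_mul]
    exact le_of_eq (by ring)

theorem LocallyBounded.exists_norm_symbol_tilde_le (hn : n ≠ 0) {ι : Type*} {w : ι → W μ n}
    (hw : LocallyBounded w) (χ : Test T) : ∃ (M : ℕ) (C : ℝ), 0 ≤ C ∧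
      (∀ a j ξ, ‖symbol e χ (fun f => approx j (w a) (tensor f)) ξ‖ ≤ C * (1 + ‖ξ‖) ^ M) ∧
      ∀ a ξ, ‖symbol e χ (tilde (w a)) ξ‖ ≤ C * (1 + ‖ξ‖) ^ M := by
  obtain ⟨M, C, hC, h⟩ := hw.exists_norm_symbol_le e hn χ
  exact ⟨M, C, hC, h, fun a ξ => le_of_tendsto
    (tendsto_symbol e χ (tendsto_pairing_tilde hn (w a)) ξ).norm
    (Filter.Eventually.of_forall fun j => h a j ξ)⟩

/-- The continuous function `w(f)`. -/
def projC (f : Test T) (w : W μ n) : C(Fin n → T, ℝ) := ⟨(proj f w).1, continuous_proj f w⟩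

theorem continuous_projC (f : Test T) : Continuous (projC f : W μ n → C(Fin n → T, ℝ)) := by
  by_cases hf : f = 0
  · have : (projC f : W μ n → C(Fin n → T, ℝ)) = fun _ => 0 := by
      ext w x
      simp only [projC, hf, proj_zero]
      rfl
    rw [this]
    exact continuous_const
  · let ev : C((Fin n → T) [×0]→L[ℝ] ℝ, ℝ) := ⟨fun l => l.curry0,
      (continuousMultilinearCurryFin0 ℝ (Fin n → T) ℝ).continuous⟩
    have h1 : Continuous (Smooth.deriv 0 : Smooth (Fin n → T) → _) :=
      continuous_iInf_dom continuous_induced_dom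
    have h2 : Continuous fun w : W μ n => ev.comp (Smooth.deriv 0 (w.1 ⟨f, hf⟩).1) :=
      (ContinuousMap.continuous_postcomp ev).comp (h1.comp (continuous_subtype_val.comp
        ((continuous_apply _).comp continuous_subtype_val)))
    refine h2.congr fun w => ?_
    ext x
    simp only [projC, proj_of_ne hf]
    rfl

theorem continuous_tilde (f : Fin n → Test T) : Continuous fun w : W μ n => tilde w f := by
  simp_rw [tilde_eq]
  have h (g : Test T) : Continuous fun w : W μ n => (proj g w).1 0 :=
    (continuous_eval_const (0 : Fin n → T)).comp (continuous_projC g)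
  exact (continuous_finsetSum _ fun S _ => (h _).const_mul _).const_mul _

/-- Evaluation $(w,x)\mapsto w(f)(x)$ is jointly continuous, hence bounded on the product of `S` and
a closed ball. -/
theorem locallyBounded_of_isCompact {S : Set (W μ n)} (hS : IsCompact S) :
    LocallyBounded (Subtype.val : S → W μ n) := fun f R => by
  have hc : Continuous fun p : W μ n × (Fin n → T) => projC f p.1 p.2 :=
    ((continuous_projC f).comp continuous_fst).eval continuous_snd
  obtain ⟨C, hC⟩ := (hS.prod (isCompact_closedBall (0 : Fin n → T) R)).exists_bound_of_continuousOn
    hc.continuousOn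
  exact ⟨C, fun a x hx => hC (a.1, x) ⟨a.2, by simpa using hx⟩⟩

theorem exists_test_eq_one (T : Type*) [NormedAddCommGroup T] [NormedSpace ℝ T]
    [FiniteDimensional ℝ T] (R : ℝ) : ∃ χ : Test T, ∀ x, ‖x‖ ≤ R → χ x = 1 := by
  let b : ContDiffBump (0 : T) := ⟨|R| + 1, |R| + 2, by positivity, by linarith⟩
  refine ⟨⟨b, b.contDiff, b.hasCompactSupport, fun _ _ => trivial⟩, fun x hx => ?_⟩
  refine b.one_of_mem_closedBall ?_
  rw [mem_closedBall_zero_iff]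
  change ‖x‖ ≤ |R| + 1
  linarith [le_abs_self R]

variable [FiniteDimensional ℝ E] [MeasurableSpace E] [BorelSpace E]

theorem stronglyMeasurable_symbol_tilde (hn : n ≠ 0) (χ : Test T) (w : W μ n) :
    StronglyMeasurable (symbol e χ (tilde w)) :=
  stronglyMeasurable_of_tendsto Filter.atTop
    (fun j => stronglyMeasurable_symbol_pairing e μ χ (continuous_proj (mollifier μ j) w))
    (tendsto_pi_nhds.2 fun ξ => tendsto_symbol e χ (tendsto_pairing_tilde hn w) ξ)

theorem integrable_one_add_norm_pow_mul {F : Type*} [NormedAddCommGroup F] [NormedSpace ℝ F]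
    [MeasurableSpace F] [BorelSpace F] [FiniteDimensional ℝ F] (ν : Measure F) [ν.IsAddHaarMeasure]
    (φ : 𝓢(F, ℂ)) (M : ℕ) : Integrable (fun ξ => (1 + ‖ξ‖) ^ M * ‖φ ξ‖) ν := by
  simp_rw [add_comm (1 : ℝ), add_pow, one_pow, mul_one, Finset.sum_mul]
  refine integrable_finsetSum _ fun i _ => ?_
  refine ((φ.integrable_pow_mul ν i).const_mul (M.choose i : ℝ)).congr
    (Filter.Eventually.of_forall fun ξ => ?_)
  simp only
  ring

/-- The symbols converge pointwise by `tendsto_pairing_tilde` and have a common polynomial bound,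
while the Fourier transform of `ψ` decays rapidly: dominated convergence in Parseval's formula. -/
theorem tendsto_approx (hn : n ≠ 0) (w : W μ n) {R : ℝ} {χ : Test T}
    (hχ : ∀ x, ‖x‖ ≤ R → χ x = 1) {ψ : Test (Fin n → T)}
    (hψ : tsupport ψ ⊆ Metric.closedBall 0 R) :
    Filter.Tendsto (fun j => approx j w ψ) Filter.atTop
      (𝓝 (∫ ξ, hat (piEquiv e n) ψ ξ * symbol e χ (tilde w) ξ).re) := by
  have hw := locallyBounded_of_isCompact (isCompact_singleton (x := w))
  obtain ⟨M, C, hC, h⟩ := hw.exists_norm_symbol_le e hn χ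
  have h1 : Filter.Tendsto (fun j => ∫ ξ, hat (piEquiv e n) ψ ξ *
      symbol e χ (fun f => approx j w (tensor f)) ξ) Filter.atTop
      (𝓝 (∫ ξ, hat (piEquiv e n) ψ ξ * symbol e χ (tilde w) ξ)) := by
    refine tendsto_integral_of_dominated_convergence
      (fun ξ => C * ((1 + ‖ξ‖) ^ M * ‖hat (piEquiv e n) ψ ξ‖)) (fun j => ?_)
      ((integrable_one_add_norm_pow_mul volume _ M).const_mul C) (fun j => ?_) ?_
    · exact (hat (piEquiv e n) ψ).continuous.aestronglyMeasurable.mul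
        (stronglyMeasurable_symbol_pairing e μ χ
          (continuous_proj (mollifier μ j) w)).aestronglyMeasurable
    · refine Filter.Eventually.of_forall fun ξ => ?_
      rw [norm_mul]
      refine (mul_le_mul_of_nonneg_left (h ⟨w, rfl⟩ j ξ) (norm_nonneg _)).trans (le_of_eq (by ring))
    · exact Filter.Eventually.of_forall fun ξ =>
        (tendsto_symbol e χ (tendsto_pairing_tilde hn w) ξ).const_mul _
  refine ((Complex.continuous_re.tendsto _).comp h1).congr fun j => ?_
  have h2 := pairing_eq_integral_hat e μ χ (continuous_proj (mollifier μ j) w) ψ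
    (tensor_eq_one hχ hψ)
  exact (congrArg Complex.re h2).symm

/-- The majorant `g` does not depend on `ψ`; this gives continuity in `ψ` and uniformity over
bounded sets. -/
theorem exists_norm_hat_le {F : Type*} {X : Type*} [NormedAddCommGroup X] [NormedSpace ℝ X]
    [NormedAddCommGroup F] [InnerProductSpace ℝ F]
    [MeasurableSpace F] [BorelSpace F] [FiniteDimensional ℝ F] (e : X ≃L[ℝ] F) {K : Set X}
    (hK : IsCompact K) (M : ℕ) : ∃ (m : ℕ) (C : ℝ) (g : F → ℝ), 0 ≤ C ∧ (∀ ξ, 0 ≤ g ξ) ∧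
      Continuous g ∧ Integrable (fun ξ => (1 + ‖ξ‖) ^ M * g ξ) ∧ ∀ ψ : Test X, tsupport ψ ⊆ K →
        ∀ ξ, ‖hat e ψ ξ‖ ≤ C * cNorm m ψ * g ξ := by
  let r := Module.finrank ℝ F + 1
  obtain ⟨m, C, hC, h⟩ := pow_mul_norm_hat_le e (M + r) hK
  have hpos (ξ : F) : 0 < 1 + ‖ξ‖ := by positivity
  refine ⟨m, C, fun ξ => ((1 + ‖ξ‖) ^ (M + r))⁻¹, hC, fun ξ => by positivity, ?_, ?_,
    fun ψ hψ ξ => ?_⟩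
  · exact Continuous.inv₀ (by fun_prop) fun ξ => (pow_pos (hpos ξ) _).ne'
  · refine (integrable_one_add_norm (μ := (volume : Measure F)) (r := r)
      (by simp [r])).congr (Filter.Eventually.of_forall fun ξ => ?_)
    have := hpos ξ
    simp only
    rw [Real.rpow_neg this.le, Real.rpow_natCast, pow_add _ M r, mul_inv,
      mul_inv_cancel_left₀ (pow_pos this M).ne']
  · rw [← div_eq_mul_inv, le_div_iff₀ (pow_pos (hpos ξ) _), mul_comm]
    exact h ψ hψ ξ

end SymbolBound

/-! ### The distribution of a Wilsonian generalized function -/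

section Dist

/-- A symmetric distribution is determined by its values on elementary tensors. -/
theorem symDist_ext {T : Type*} [NormedAddCommGroup T] [NormedSpace ℝ T]
    [FiniteDimensional ℝ T] {n : ℕ} {ω₁ ω₂ : SymDist T n}
    (h : ∀ f, ω₁.1 (tensor f) = ω₂.1 (tensor f)) :
    ω₁ = ω₂ := by
  let := borel T
  have : BorelSpace T := ⟨rfl⟩
  refine Subtype.ext (sub_eq_zero.1 (eq_zero_of_tensor_eq_zero (ω₁.1 - ω₂.1) fun f => ?_))
  rw [sub_apply, h, sub_self]

variable {T : Type*} [NormedAddCommGroup T] [NormedSpace ℝ T] [FiniteDimensional ℝ T]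
  [MeasurableSpace T] [BorelSpace T] {μ : Measure T} [μ.IsAddHaarMeasure] {n : ℕ}
  {E : Type*} [NormedAddCommGroup E] [InnerProductSpace ℝ E] (e : T ≃L[ℝ] E)
  [FiniteDimensional ℝ E] [MeasurableSpace E] [BorelSpace E]

theorem exists_abs_integral_hat_mul_symbol_le (hn : n ≠ 0) (w : W μ n) (χ : Test T)
    {K : Set (Fin n → T)} (hK : IsCompact K) : ∃ (m : ℕ) (C : ℝ), 0 ≤ C ∧
      ∀ ψ : Test (Fin n → T), tsupport ψ ⊆ K →
        |(∫ ξ, hat (piEquiv e n) ψ ξ * symbol e χ (tilde w) ξ).re| ≤ C * cNorm m ψ := by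
  obtain ⟨M, C, hC, -, h⟩ := (locallyBounded_of_isCompact
    (isCompact_singleton (x := w))).exists_norm_symbol_tilde_le e hn χ
  obtain ⟨m, D, g, hD, hg0, -, hgi, hg⟩ := exists_norm_hat_le (piEquiv e n) hK M
  refine ⟨m, D * C * ∫ ξ, (1 + ‖ξ‖) ^ M * g ξ, mul_nonneg (mul_nonneg hD hC)
    (integral_nonneg fun ξ => mul_nonneg (by positivity) (hg0 ξ)), fun ψ hψ => ?_⟩
  refine (Complex.abs_re_le_norm _).trans ((norm_integral_le_of_norm_le
    (hgi.const_mul (D * cNorm m ψ * C)) (Filter.Eventually.of_forall fun ξ => ?_)).trans ?_)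
  · rw [norm_mul]
    refine (mul_le_mul (hg ψ hψ ξ) (h ⟨w, rfl⟩ ξ) (norm_nonneg _) (mul_nonneg
      (mul_nonneg hD (cNorm_nonneg _ _)) (hg0 ξ))).trans (le_of_eq (by ring))
  · rw [integral_const_mul]
    exact le_of_eq (by ring)

/-- The distribution of `w`, and its Fourier representation on the test functions supported in a
given ball. -/
theorem exists_symDist (hn : n ≠ 0) (w : W μ n) : ∃ ω : SymDist T n,
    (∀ f, ω.1 (tensor f) = tilde w f) ∧
    ∀ (R : ℝ) (χ : Test T), (∀ x, ‖x‖ ≤ R → χ x = 1) → ∀ ψ : Test (Fin n → T),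
      tsupport ψ ⊆ Metric.closedBall 0 R →
        ω.1 ψ = (∫ ξ, hat (piEquiv e n) ψ ξ * symbol e χ (tilde w) ξ).re := by
  have hlim (ψ : Test (Fin n → T)) :
      ∃ L, Filter.Tendsto (fun j => approx j w ψ) Filter.atTop (𝓝 L) := by
    obtain ⟨R, hR⟩ := ψ.hasCompactSupport.isCompact.isBounded.subset_closedBall 0
    obtain ⟨χ, hχ⟩ := exists_test_eq_one T R
    exact ⟨_, tendsto_approx e hn w hχ hR⟩
  -- Being a limit of forms that do not involve the cut-off, `L` is linear and independent of the
  -- choice of `R` and `χ`.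
  choose L hL using hlim
  let l : Test (Fin n → T) →ₗ[ℝ] ℝ :=
    { toFun := L
      map_add' := fun ψ θ => tendsto_nhds_unique (hL (ψ + θ))
        (((hL ψ).add (hL θ)).congr fun j => (map_add _ _ _).symm)
      map_smul' := fun c ψ => tendsto_nhds_unique (hL (c • ψ))
        (((hL ψ).const_mul c).congr fun j => (map_smul (approx j w) c ψ).symm) }
  have hrep (R : ℝ) (χ : Test T) (hχ : ∀ x, ‖x‖ ≤ R → χ x = 1) (ψ : Test (Fin n → T))
      (hψ : tsupport ψ ⊆ Metric.closedBall 0 R) :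
      l ψ = (∫ ξ, hat (piEquiv e n) ψ ξ * symbol e χ (tilde w) ξ).re :=
    tendsto_nhds_unique (hL ψ) (tendsto_approx e hn w hχ hψ)
  have hcont : Continuous l := by
    refine continuous_of_bound l fun K hK => ?_
    obtain ⟨R, hR⟩ := hK.isBounded.subset_closedBall 0
    obtain ⟨χ, hχ⟩ := exists_test_eq_one T R
    obtain ⟨m, C, hC, h⟩ := exists_abs_integral_hat_mul_symbol_le e hn w χ hK
    refine ⟨m, C, hC, fun ψ hψ => ?_⟩
    rw [hrep R χ hχ ψ (hψ.trans hR)]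
    exact h ψ hψ
  exact ⟨⟨⟨l, hcont⟩, fun σ ψ => tendsto_nhds_unique (hL (permute σ ψ))
    ((hL ψ).congr fun j => (pairing_proj_permute _ w σ ψ).symm)⟩,
    fun f => tendsto_nhds_unique (hL (tensor f)) (tendsto_pairing_tilde hn w f), hrep⟩

/-- The only subset is empty, and its sum is the zero function, where $\Pi_0=0$. -/
theorem tilde_eq_zero_of_eq_zero (hn : n = 0) (w : W μ n) (f : Fin n → Test T) :
    tilde w f = 0 := by
  subst hn
  rw [tilde_eq]
  refine mul_eq_zero_of_right _ (Finset.sum_eq_zero fun S _ => mul_eq_zero_of_right _ ?_)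
  rw [Finset.sum_eq_zero fun i _ => i.elim0, proj_zero]
  rfl

theorem exists_symDist_tensor_eq (w : W μ n) :
    ∃ ω : SymDist T n, ∀ f, ω.1 (tensor f) = tilde w f := by
  by_cases hn : n = 0
  · exact ⟨0, fun f => (tilde_eq_zero_of_eq_zero hn w f).symm⟩
  · obtain ⟨ω, h, -⟩ := exists_symDist (toEuclidean (E := T)) hn w
    exact ⟨ω, h⟩

/-- The map `k` from Wilsonian generalized functions to distributions. -/
def toDist : W μ n →ₗ[ℝ] SymDist T n where
  toFun w := (exists_symDist_tensor_eq w).choose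
  map_add' w₁ w₂ := symDist_ext fun f => by
    rw [(exists_symDist_tensor_eq (w₁ + w₂)).choose_spec, tilde_add,
      ← (exists_symDist_tensor_eq w₁).choose_spec, ← (exists_symDist_tensor_eq w₂).choose_spec]
    rfl
  map_smul' c w := symDist_ext fun f => by
    rw [(exists_symDist_tensor_eq (c • w)).choose_spec, tilde_smul,
      ← (exists_symDist_tensor_eq w).choose_spec]
    rfl

theorem toDist_tensor (w : W μ n) (f : Fin n → Test T) : (toDist w).1 (tensor f) = tilde w f :=
  (exists_symDist_tensor_eq w).choose_spec f

theorem eq_toDist_iff (w : W μ n) (ω : SymDist T n) :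
    ω = toDist w ↔ ∀ f, ω.1 (tensor f) = tilde w f :=
  ⟨fun h f => by rw [h, toDist_tensor], fun h => symDist_ext fun f => by rw [h, toDist_tensor]⟩

theorem toDist_eq_integral (hn : n ≠ 0) (w : W μ n) {R : ℝ} {χ : Test T}
    (hχ : ∀ x, ‖x‖ ≤ R → χ x = 1) {ψ : Test (Fin n → T)}
    (hψ : tsupport ψ ⊆ Metric.closedBall 0 R) :
    (toDist w).1 ψ = (∫ ξ, hat (piEquiv e n) ψ ξ * symbol e χ (tilde w) ξ).re := by
  obtain ⟨ω, h, h'⟩ := exists_symDist e hn w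
  rw [← (eq_toDist_iff w ω).2 h]
  exact h' R χ hχ ψ hψ

theorem bijective_toDist (hn : n ≠ 0) : Function.Bijective (toDist : W μ n →ₗ[ℝ] SymDist T n) := by
  refine ⟨(injective_iff_map_eq_zero _).2 fun w hw => eq_zero_of_tilde_eq_zero hn w fun f => ?_,
    fun ω => ⟨ofDist μ ω, ((eq_toDist_iff _ ω).2 fun f => (tilde_ofDist hn ω f).symm).symm⟩⟩
  rw [← toDist_tensor, hw]
  rfl

theorem continuous_toDist_weak :
    Continuous[instTopologicalSpaceSubtype, weakTensorTopology T n]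
      (toDist : W μ n →ₗ[ℝ] SymDist T n) := by
  refine continuous_induced_rng.2 (continuous_pi fun ψ => ?_)
  change Continuous fun w : W μ n => (toDist w).1 ψ.1
  obtain ⟨ψ, hψ⟩ := ψ
  change Continuous fun w : W μ n => (toDist w).1 ψ
  induction hψ using Submodule.span_induction with
  | mem x hx =>
    obtain ⟨f, rfl⟩ := hx
    simp_rw [toDist_tensor]
    exact continuous_tilde f
  | zero => simpa only [map_zero] using continuous_const
  | add x y _ _ hx hy =>
    simp only [map_add]
    exact hx.add hy
  | smul c x _ hx =>
    simp only [map_smul]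
    exact hx.const_smul c

theorem integrable_hat_mul_symbol (hn : n ≠ 0) (w : W μ n) (χ : Test T)
    (ψ : Test (Fin n → T)) :
    Integrable fun ξ => hat (piEquiv e n) ψ ξ * symbol e χ (tilde w) ξ := by
  obtain ⟨M, C, hC, -, h⟩ := (locallyBounded_of_isCompact
    (isCompact_singleton (x := w))).exists_norm_symbol_tilde_le e hn χ
  refine ((integrable_one_add_norm_pow_mul volume (hat (piEquiv e n) ψ) M).const_mul C).mono'
    ((hat (piEquiv e n) ψ).continuous.aestronglyMeasurable.mul
      (stronglyMeasurable_symbol_tilde e hn χ w).aestronglyMeasurable)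
    (Filter.Eventually.of_forall fun ξ => ?_)
  rw [norm_mul]
  exact (mul_le_mul_of_nonneg_left (h ⟨w, rfl⟩ ξ) (norm_nonneg _)).trans (le_of_eq (by ring))

/-- On `B` the difference is at most a constant times $\int g\,|q_l|$, where $q_l$ is the difference
of the symbols and `g` majorizes all Fourier transforms up to that constant; this integral tends to
$0$. -/
theorem tendstoUniformlyOn_toDist (hn : n ≠ 0) {u : ℕ → W μ n} {w : W μ n}
    (hu : Filter.Tendsto u Filter.atTop (𝓝 w)) {B : Set (Test (Fin n → T))}
    (hB : Bornology.IsVonNBounded ℝ B) :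
    TendstoUniformlyOn (fun l ψ => (toDist (u l)).1 ψ) (toDist w).1 Filter.atTop B := by
  obtain ⟨R, hR⟩ := exists_tsupport_subset_of_isVonNBounded hB
  obtain ⟨χ, hχ⟩ := exists_test_eq_one T R
  let e := toEuclidean (E := T)
  -- Sequences matter here: with the limit they form a compact set. They matter again in the
  -- dominated convergence below.
  obtain ⟨M, C, hC, -, h⟩ := (locallyBounded_of_isCompact
    hu.isCompact_insert_range).exists_norm_symbol_tilde_le e hn χ
  obtain ⟨m, D, g, hD, hg0, hgc, hgi, hg⟩ := exists_norm_hat_le (piEquiv e n)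
    (isCompact_closedBall (0 : Fin n → T) R) M
  obtain ⟨A, hA, hAB⟩ := exists_cNorm_le_of_isVonNBounded hB m
  let q (l : ℕ) (ξ : PiLp 2 fun _ : Fin n => EuclideanSpace ℝ (Fin (Module.finrank ℝ T))) : ℂ :=
    symbol e χ (tilde (u l)) ξ - symbol e χ (tilde w) ξ
  have hqm (l : ℕ) : StronglyMeasurable (q l) :=
    (stronglyMeasurable_symbol_tilde e hn χ (u l)).sub (stronglyMeasurable_symbol_tilde e hn χ w)
  have hq0 (ξ) : Filter.Tendsto (fun l => q l ξ) Filter.atTop (𝓝 0) := by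
    rw [← sub_self (symbol e χ (tilde w) ξ)]
    exact (tendsto_symbol e χ (fun f => ((continuous_tilde f).tendsto w).comp hu) ξ).sub_const _
  have hqb (l : ℕ) (ξ) : ‖g ξ * ‖q l ξ‖‖ ≤ 2 * C * ((1 + ‖ξ‖) ^ M * g ξ) := by
    have h1 := norm_sub_le (symbol e χ (tilde (u l)) ξ) (symbol e χ (tilde w) ξ)
    have h2 := h ⟨u l, Or.inr ⟨l, rfl⟩⟩ ξ
    have h3 := h ⟨w, Or.inl rfl⟩ ξ
    rw [norm_mul, norm_norm, Real.norm_of_nonneg (hg0 ξ)]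
    calc g ξ * ‖q l ξ‖ ≤ g ξ * (2 * (C * (1 + ‖ξ‖) ^ M)) :=
          mul_le_mul_of_nonneg_left (by simp only [q]; linarith) (hg0 ξ)
      _ = _ := by ring
  have hqi (l : ℕ) : Integrable fun ξ => g ξ * ‖q l ξ‖ :=
    (hgi.const_mul (2 * C)).mono' (hgc.aestronglyMeasurable.mul
      (hqm l).norm.aestronglyMeasurable) (Filter.Eventually.of_forall (hqb l))
  have hlim : Filter.Tendsto (fun l => D * A * ∫ ξ, g ξ * ‖q l ξ‖) Filter.atTop (𝓝 0) := by
    have h1 : Filter.Tendsto (fun l => ∫ ξ, g ξ * ‖q l ξ‖) Filter.atTop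
        (𝓝 (∫ ξ, g ξ * ‖(0 : ℂ)‖)) :=
      tendsto_integral_of_dominated_convergence _ (fun l => (hqi l).aestronglyMeasurable)
        (hgi.const_mul (2 * C)) (fun l => Filter.Eventually.of_forall (hqb l))
        (Filter.Eventually.of_forall fun ξ => (hq0 ξ).norm.const_mul _)
    simpa using h1.const_mul (D * A)
  have hbound (l : ℕ) (ψ) (hψ : ψ ∈ B) :
      dist ((toDist w).1 ψ) ((toDist (u l)).1 ψ) ≤ D * A * ∫ ξ, g ξ * ‖q l ξ‖ := by
    rw [toDist_eq_integral e hn w hχ (hR ψ hψ), toDist_eq_integral e hn (u l) hχ (hR ψ hψ),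
      dist_comm, Real.dist_eq, ← Complex.sub_re,
      ← integral_sub (integrable_hat_mul_symbol e hn _ χ ψ) (integrable_hat_mul_symbol e hn _ χ ψ),
      ← integral_const_mul]
    refine (Complex.abs_re_le_norm _).trans (norm_integral_le_of_norm_le
      ((hqi l).const_mul (D * A)) (Filter.Eventually.of_forall fun ξ => ?_))
    rw [← mul_sub, norm_mul, ← mul_assoc]
    refine mul_le_mul_of_nonneg_right ((hg ψ (hR ψ hψ) ξ).trans ?_) (norm_nonneg _)
    exact mul_le_mul_of_nonneg_right (mul_le_mul_of_nonneg_left (hAB ψ hψ) hD) (hg0 ξ)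
  refine Metric.tendstoUniformlyOn_iff.2 fun ε hε => ?_
  filter_upwards [hlim.eventually_lt_const hε] with l hl ψ hψ
  exact (hbound l ψ hψ).trans_lt hl

theorem seqContinuous_toDist : SeqContinuous (toDist : W μ n →ₗ[ℝ] SymDist T n) := by
  intro u w hu
  by_cases hn : n = 0
  · have h (w : W μ n) : toDist w = 0 :=
      ((eq_toDist_iff w 0).2 fun f => (tilde_eq_zero_of_eq_zero hn w f).symm).symm
    simp only [Function.comp_def, h]
    exact tendsto_const_nhds
  · exact tendsto_subtype_rng.2 ((UniformConvergenceCLM.tendsto_iff_tendstoUniformlyOn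
      (RingHom.id ℝ) ℝ {S : Set (Test (Fin n → T)) | Bornology.IsVonNBounded ℝ S}).2
        fun B hB => tendstoUniformlyOn_toDist hn hu hB)

end Dist

end Wilson

end

theorem mainTheorem3 {T : Type*} [NormedAddCommGroup T] [NormedSpace ℝ T] [FiniteDimensional ℝ T]
    [MeasurableSpace T] [BorelSpace T] (μ : Measure T) [μ.IsAddHaarMeasure] (n : ℕ) :
    ∃ k : Wilson.W μ n →ₗ[ℝ] Wilson.SymDist T n,
      -- `k w` is the distribution extending `w̃`, and it is the only one
      (∀ (w : Wilson.W μ n) (ω : Wilson.SymDist T n),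
        ω = k w ↔ ∀ f : Fin n → Wilson.Test T, ω.1 (Wilson.tensor f) = Wilson.tilde w f) ∧
      (n ≠ 0 → Function.Bijective k) ∧
      Continuous[instTopologicalSpaceSubtype, Wilson.weakTensorTopology T n] k ∧
      SeqContinuous k :=
  ⟨Wilson.toDist, Wilson.eq_toDist_iff, Wilson.bijective_toDist, Wilson.continuous_toDist_weak,
    Wilson.seqContinuous_toDist⟩
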